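/- **Setting.** Let $d\ge 1$, $V=\{1,\dots,d\}$. A Lévy measure on $\mathbb R^d$ is a Borel measure $\Lambda$ with $\Lambda(\{0\})=0$ and $\int (1\wedge\|x\|^2)\,\Lambda(dx)<\infty$. Its marginal tail functions are $U_i(x)=\Lambda(y: y_i\ne 0,\ y_i\ge x)$ for $x\ge 0$ and $U_i(x)=\Lambda(y: y_i\le x)$ for $x<0$. For $s\in\{+1,-1\}^d$ let $\mathcal O_s=\{x\in\mathbb R^d: \text{for every } i,\ s_ix_i>0 \text{ or } (x_i=0 \text{ and } s_i=+1)\}$. Say that a measure $\Lambda^*$ carries the dependence structure of $\Lambda$ if for all $s$ and all $x\in\mathcal O_s$ $$\Lambda(y: s_iy_i\ge s_ix_i\ \forall i\in V)=\Lambda^*(y: s_iy_i\ge 1/U_i(x_i)\ \forall i\in V)\qquad(1)$$ (with $1/\infty=0$, $1/0=\infty$). A standardized Lévy measure associated with $\Lambda$ is a Lévy measure $\Lambda^*$ satisfying (1) and $\Lambda^*(y:y_i>x)=\Lambda^*(y:y_i<-x)=1/x$ for all $x>0$, $i\in V$. **Model.** Let $T=(V,E)$ be a tree. For each edge $(i,j)\in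 E$ let $m_{ij}\in[0,1]$ and let $g_{ij}$ be the Lebesgue density of a measure $\mu_{ij}$ on $\mathbb R^2$ concentrated on $(0,\infty)^2$ with $\mu_{ij}(hA)=h^{-1}\mu_{ij}(A)$ for all $h>0$ and Borel sets $A$, and $\mu_{ij}(y_1>x)=\mu_{ij}(y_2>x)=1/x$ for all $x>0$. Put $\lambda_i(a)=a^{-2}$ for $a\neq0$, and $\lambda_{ij}(a,b)=m_{ij}\,g_{ij}(|a|,|b|)$ if $ab>0$, $\lambda_{ij}(a,b)=(1-m_{ij})\,g_{ij}(|a|,|b|)$ if $ab<0$. The measure on $\mathbb R^d$ with Lebesgue density $$\prod_{(i,j)\in E}\frac{\lambda_{ij}(y_i,y_j)}{\lambda_i(y_i)\lambda_j(y_j)}\ \prod_{i\in V}\lambda_i(y_i)$$ is called a tree measure on $T$. A Lévy measure $\Lambda$ on $\mathbb R^d$ follows the heterogeneous stable model on $T$ if some tree measure on $T$ carries the dependence structure of $\Lambda$ and if $U_i(\pm x)=c_i^{\pm}x^{-\alpha_i}$ for all $x>0$, $i\in V$, with some $c_i^\pm>0$ and $\alpha_i\in(0,2)$. **Statement.** Let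 $\mathbf X$ be a $d$-dimensional Lévy process with characteristic triplet $(\gamma,0,\Lambda)$, $\gamma\in\mathbb R^d$ (no Brownian part), where $\Lambda$ follows the heterogeneous stable model on the tree $T=(V,E)$. Let $\Lambda^*$ be a standardized Lévy measure associated with $\Lambda$, and define the Lévy correlations $$\chi_{ij}=\tfrac12\,\Lambda^*(y:|y_i|>1,\ |y_j|>1),\qquad i,j\in V.$$ 1. For all $h,l\in V$ and every edge $(i,j)$ on the path from $h$ to $l$ in $T$, $\chi_{hl}\le\chi_{ij}$. 2. Suppose that in addition, for all $h,l\in V$ and every edge $(i,j)$ on the path from $h$ to $l$ in $T$ with $\{i,j\}\ne\{h,l\}$, the inequality is strict: $\chi_{hl}<\chi_{ij}$. Then the problem of minimizing $\sum_{(i,j)\in E'}-\log\chi_{ij}$ over all trees $T'=(V,E')$ on $V$ has a unique solution, and this solution is $T$. -/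

import Mathlib

open MeasureTheory ProbabilityTheory Filter Topology
open scoped NNReal ENNReal

namespace LevyTree

/-- The state space `ℝ^d` with its Euclidean structure; `V = Fin d`. -/
abbrev E (d : ℕ) : Type := EuclideanSpace ℝ (Fin d)

/-! ### Lévy processes and characteristic triplets -/

/-- A `d`-dimensional Lévy process. -/
structure IsLevyProcess {d : ℕ} {Ω : Type*} [MeasurableSpace Ω] (P : Measure Ω)
    (X : ℝ≥0 → Ω → E d) : Prop where
  measurable : ∀ t, Measurable (X t)
  start_zero : ∀ᵐ ω ∂P, X 0 ω = 0
  indep_increments : HasIndepIncrements X P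
  stationary_increments : ∀ s t : ℝ≥0,
    IdentDistrib (fun ω => X (s + t) ω - X s ω) (fun ω => X t ω - X 0 ω) P P
  cadlag : ∀ᵐ ω ∂P, ∀ t : ℝ≥0,
    ContinuousWithinAt (fun r => X r ω) (Set.Ici t) t ∧
      ∃ l : E d, Tendsto (fun r => X r ω) (𝓝[<] t) (𝓝 l)

/-- A Lévy measure on `ℝ^d`: no mass at the origin, and `∫ (1 ∧ ‖x‖²) dΛ < ∞`. -/
def IsLevyMeasure {d : ℕ} (Λ : Measure (E d)) : Prop :=
  Λ {0} = 0 ∧ ∫⁻ x, ENNReal.ofReal (min 1 (‖x‖ ^ 2)) ∂Λ < ∞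

/-- The Lévy–Khintchine exponent of the triplet `(γ, S, Λ)`. -/
noncomputable def levyExponent {d : ℕ} (γ : E d) (S : Matrix (Fin d) (Fin d) ℝ)
    (Λ : Measure (E d)) (u : E d) : ℂ :=
  Complex.I * (inner ℝ u γ : ℝ)
    - (1 / 2 : ℂ) * ((∑ i, ∑ j, u i * S i j * u j : ℝ) : ℂ)
    + ∫ x, (Complex.exp (Complex.I * (inner ℝ u x : ℝ)) - 1
        - (if ‖x‖ ≤ 1 then Complex.I * (inner ℝ u x : ℝ) else 0)) ∂Λ

/-- `X` has characteristic triplet `(γ, S, Λ)`. -/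
def HasTriplet {d : ℕ} {Ω : Type*} [MeasurableSpace Ω] (P : Measure Ω) (X : ℝ≥0 → Ω → E d)
    (γ : E d) (S : Matrix (Fin d) (Fin d) ℝ) (Λ : Measure (E d)) : Prop :=
  S.PosSemidef ∧ IsLevyMeasure Λ ∧
    ∀ u : E d, ∫ ω, Complex.exp (Complex.I * (inner ℝ u (X 1 ω) : ℝ)) ∂P
      = Complex.exp (levyExponent γ S Λ u)

/-! ### Standardized Lévy measures -/

/-- The sign `s i ∈ {+1, -1}` as a real number. -/
def sgn {d : ℕ} (s : Fin d → ℤˣ) (i : Fin d) : ℝ := ((s i : ℤ) : ℝ)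

/-- The orthant `O_s`; sub-faces belong to the nonnegative side, so the orthants are disjoint. -/
def orthant {d : ℕ} (s : Fin d → ℤˣ) : Set (E d) :=
  {x | ∀ i, 0 < sgn s i * x i ∨ (x i = 0 ∧ s i = 1)}

/-- The marginal tail function `U_i` of `Λ`: `U_i(x) = Λ_i[x, ∞)` for `x ≥ 0` and
`U_i(x) = Λ_i(-∞, x]` for `x < 0`, where `Λ_i` is the `i`th marginal of `Λ`,
a measure on `ℝ \ {0}`. -/
noncomputable def tail {d : ℕ} (Λ : Measure (E d)) (i : Fin d) (x : ℝ) : ℝ≥0∞ :=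
  if 0 ≤ x then Λ {y | y i ≠ 0 ∧ x ≤ y i} else Λ {y | y i ≠ 0 ∧ y i ≤ x}

/-- `Λstar` carries the dependence structure of `Λ`: on every orthant `O_s`,
`Λ(s_i y_i ≥ s_i x_i ∀ i) = Λstar(s_i y_i ≥ 1 / U_i(x_i) ∀ i)` for all `x ∈ O_s`. The comparison
is made in the extended reals since `1 / U_i(x_i) ∈ [0, ∞]`. -/
def SameDependence {d : ℕ} (Λ Λstar : Measure (E d)) : Prop :=
  ∀ (s : Fin d → ℤˣ), ∀ x ∈ orthant s,
    Λ {y | ∀ i, sgn s i * x i ≤ sgn s i * y i}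
      = Λstar {y | ∀ i, (((tail Λ i (x i))⁻¹ : ℝ≥0∞) : EReal) ≤ ((sgn s i * y i : ℝ) : EReal)}

/-- `Λstar` is a standardized Lévy measure associated with `Λ`. -/
structure IsStandardizedOf {d : ℕ} (Λstar Λ : Measure (E d)) : Prop where
  isLevyMeasure : IsLevyMeasure Λstar
  margin_pos : ∀ i, ∀ x : ℝ, 0 < x → Λstar {y | x < y i} = ENNReal.ofReal (1 / x)
  margin_neg : ∀ i, ∀ x : ℝ, 0 < x → Λstar {y | y i < -x} = ENNReal.ofReal (1 / x)
  sameDependence : SameDependence Λ Λstar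

/-! ### The heterogeneous stable tree model -/

/-- `g` is the Lebesgue density of a bivariate `-1`-homogeneous standardized Lévy measure with mass
only on the positive quadrant. -/
structure IsPositiveModel (g : ℝ × ℝ → ℝ≥0∞) : Prop where
  measurable : Measurable g
  support : ∀ y : ℝ × ℝ, ¬ (0 < y.1 ∧ 0 < y.2) → g y = 0
  homogeneous : ∀ h : ℝ, 0 < h → ∀ A : Set (ℝ × ℝ), MeasurableSet A →
    (volume.withDensity g) ((fun y => h • y) '' A)
      = ENNReal.ofReal h⁻¹ * (volume.withDensity g) A
  margin_fst : ∀ x : ℝ, 0 < x → (volume.withDensity g) {y | x < y.1} = ENNReal.ofReal (1 / x)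
  margin_snd : ∀ x : ℝ, 0 < x → (volume.withDensity g) {y | x < y.2} = ENNReal.ofReal (1 / x)

/-- The bivariate density obtained by reflecting the positive model `g` into the four quadrants,
with weight `m` on `++` and `--` and weight `1 - m` on `+-` and `-+`. -/
noncomputable def edgeDensity (m : ℝ) (g : ℝ × ℝ → ℝ≥0∞) (a b : ℝ) : ℝ≥0∞ :=
  if 0 < a * b then ENNReal.ofReal m * g (|a|, |b|)
  else if a * b < 0 then ENNReal.ofReal (1 - m) * g (|a|, |b|)
  else 0

/-- The univariate marginal density `y ↦ y⁻²` on `ℝ \ {0}` of a standardized Lévy measure, that is,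
the density of the measure with mass `1 / x` on `(x, ∞)` and on `(-∞, -x)`. -/
noncomputable def marginDensity (a : ℝ) : ℝ≥0∞ := ENNReal.ofReal (1 / a ^ 2)

open Classical in
/-- The edges of `G`, each listed once, as the pair `(i, j)` with `i < j`. -/
noncomputable def edgePairs {d : ℕ} (G : SimpleGraph (Fin d)) : Finset (Fin d × Fin d) :=
  Finset.univ.filter fun e => e.1 < e.2 ∧ G.Adj e.1 e.2

/-- The density `∏_{(i,j) ∈ E} λ_ij(y_i, y_j) / (λ_i(y_i) λ_j(y_j)) · ∏_i λ_i(y_i)`. -/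
noncomputable def treeDensity {d : ℕ} (T : SimpleGraph (Fin d)) (m : Fin d → Fin d → ℝ)
    (g : Fin d → Fin d → ℝ × ℝ → ℝ≥0∞) (y : E d) : ℝ≥0∞ :=
  (∏ e ∈ edgePairs T, edgeDensity (m e.1 e.2) (g e.1 e.2) (y e.1) (y e.2)
      / (marginDensity (y e.1) * marginDensity (y e.2)))
    * ∏ i, marginDensity (y i)

/-- `Λ` is the Lévy measure of a heterogeneous stable model on the tree `T`: its dependence
structure is the tree measure built from bivariate models and asymmetry parameters on the edges,
and its marginal tails are `U_i(±x) = c_i^± x^{-α_i}` with `c_i^± > 0` and `α_i ∈ (0, 2)`. -/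
def IsHeteroStableTree {d : ℕ} (T : SimpleGraph (Fin d)) (Λ : Measure (E d)) : Prop :=
  T.IsTree ∧ IsLevyMeasure Λ ∧
  ∃ (m : Fin d → Fin d → ℝ) (g : Fin d → Fin d → ℝ × ℝ → ℝ≥0∞) (cpos cneg α : Fin d → ℝ),
    (∀ e ∈ edgePairs T, m e.1 e.2 ∈ Set.Icc (0 : ℝ) 1 ∧ IsPositiveModel (g e.1 e.2)) ∧
    (∀ i, 0 < cpos i ∧ 0 < cneg i ∧ α i ∈ Set.Ioo (0 : ℝ) 2) ∧
    (∀ i, ∀ x : ℝ, 0 < x →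
      tail Λ i x = ENNReal.ofReal (cpos i * x ^ (-α i)) ∧
      tail Λ i (-x) = ENNReal.ofReal (cneg i * x ^ (-α i))) ∧
    SameDependence Λ (volume.withDensity (treeDensity T m g))

/-! ### Lévy correlations and minimum spanning trees -/

/-- The Lévy correlation `χ_ij = Λstar(|y_i| > 1, |y_j| > 1) / 2`. -/
noncomputable def chi {d : ℕ} (Λstar : Measure (E d)) (i j : Fin d) : ℝ :=
  (Λstar {y | 1 < |y i| ∧ 1 < |y j|}).toReal / 2

/-- The total weight `∑_{(i,j) ∈ E} w_ij`, for symmetric weights `w`. -/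
noncomputable def totalWeight {d : ℕ} (w : Fin d → Fin d → ℝ) (G : SimpleGraph (Fin d)) : ℝ :=
  ∑ e ∈ edgePairs G, w e.1 e.2

/-- `G` is a minimum spanning tree on the vertex set `Fin d` for the weights `w`. -/
def IsMinSpanningTree {d : ℕ} (w : Fin d → Fin d → ℝ) (G : SimpleGraph (Fin d)) : Prop :=
  G.IsTree ∧ ∀ G' : SimpleGraph (Fin d), G'.IsTree → totalWeight w G ≤ totalWeight w G'

end LevyTree

/-! Under a tree measure, the coordinates along the path from `h` to `l` form a Markov chain,
reversible with respect to the infinite measure with density `marginDensity`. The edge densities are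
homogeneous of degree `-3` and invariant under a joint sign change. Hence the law of `Y_j` given
`Y_i = t a` with `t > 0` is that of `t Y_j` given `Y_i = a`, and the transition operators preserve
functions nondecreasing in `|a|` (`IsEdgeKernel.radialMono_transition`). In particular `φ(b) =
P(|Y_l| > 1 | Y_v = b)` is such a function.

Let `u` precede `v` on the path. By reversibility the mass of `{|Y_u| > 1, |Y_l| > 1}` is the
integral of `F φ` against `marginDensity`, where `F(b) = P(|Y_u| > 1 | Y_v = b)`. Since `0 ≤ F ≤ 1`
and `F` has the same total mass as the indicator of `{|b| > 1}`, a bathtub argument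
(`lintegral_mul_le_of_radialMono`) bounds this by the mass of `{|Y_v| > 1, |Y_l| > 1}`. So dropping
an end vertex of a path never lowers the correlation, and trimming from both ends leaves any chosen
edge.

Two reductions lead to this setting. The measure `Λstar` and the tree measure both carry the
dependence structure of `Λ`, whose power tails take every positive value, so they agree on joint
exceedance sets (`measure_abs_gt_eq_of_sameDependence`). The given densities are homogeneous only
almost everywhere, so they are replaced by exact versions. Vertices off the path integrate out
because the kernels have total mass one.

For the second claim, the correlations are positive, so `-log` reverses their order strictly: every
non-edge is heavier than each tree edge on the path it closes. Exchanging edges then rules out any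
other minimizer. -/

namespace LevyTree

/-! ### Edge exchange and uniqueness of the minimum spanning tree -/

section MinimumSpanningTree

open Classical in
theorem totalWeight_eq_sum_edgeFinset {d : ℕ} (w : Fin d → Fin d → ℝ)
    (hw : ∀ i j, w i j = w j i) (G : SimpleGraph (Fin d)) :
    totalWeight w G = ∑ e ∈ G.edgeFinset, Sym2.lift ⟨w, hw⟩ e := by
  unfold totalWeight
  refine Finset.sum_nbij (fun e => s(e.1, e.2)) ?_ ?_ ?_ ?_
  · rintro ⟨i, j⟩ h
    simpa using ((Finset.mem_filter.1 h).2).2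
  · rintro ⟨i, j⟩ h ⟨i', j'⟩ h' heq
    have h1 := ((Finset.mem_filter.1 (Finset.mem_coe.1 h)).2).1
    have h2 := ((Finset.mem_filter.1 (Finset.mem_coe.1 h')).2).1
    simp only [Sym2.eq_iff] at heq
    rcases heq with ⟨rfl, rfl⟩ | ⟨rfl, rfl⟩
    · rfl
    · exact absurd h1 (lt_asymm h2)
  · intro e he
    induction e with
    | h i j =>
      have hadj : G.Adj i j := by simpa using he
      rcases lt_or_gt_of_ne hadj.ne with hlt | hlt
      · exact ⟨(i, j), by simp [edgePairs, hlt, hadj], rfl⟩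
      · exact ⟨(j, i), by simp [edgePairs, hlt, hadj.symm], Sym2.eq_swap⟩
  · rintro ⟨i, j⟩ _
    rfl

/-- Replacing an edge `s(h, l)` of a tree by an edge `s(i, j)` that joins the two components left
after its removal. -/
theorem isTree_exchange {V : Type*} [Finite V] {G : SimpleGraph V} (hG : G.IsTree)
    {h l i j : V} (hhl : G.Adj h l)
    (hi : (G.deleteEdges {s(h, l)}).Reachable h i)
    (hj : ¬ (G.deleteEdges {s(h, l)}).Reachable h j) :
    (G.deleteEdges {s(h, l)} ⊔ SimpleGraph.edge i j).IsTree ∧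
      s(i, j) ∉ (G.deleteEdges {s(h, l)}).edgeSet ∧
      (G.deleteEdges {s(h, l)} ⊔ SimpleGraph.edge i j).edgeSet
        = insert s(i, j) (G.edgeSet \ {s(h, l)}) := by
  have hij : i ≠ j := by rintro rfl; exact hj hi
  have hside : ∀ x, (G.deleteEdges {s(h, l)}).Reachable h x ∨
      (G.deleteEdges {s(h, l)}).Reachable l x := by
    have key : ∀ {a b : V}, G.Walk a b → ((G.deleteEdges {s(h, l)}).Reachable h a ∨
        (G.deleteEdges {s(h, l)}).Reachable l a) → ((G.deleteEdges {s(h, l)}).Reachable h b ∨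
        (G.deleteEdges {s(h, l)}).Reachable l b) := by
      intro a b p
      induction p with
      | nil => exact id
      | @cons a c b hac p ih =>
        intro ha
        apply ih
        by_cases he : s(a, c) = s(h, l)
        · rw [Sym2.eq_iff] at he
          rcases he with ⟨rfl, rfl⟩ | ⟨rfl, rfl⟩
          · exact Or.inr (SimpleGraph.Reachable.refl _)
          · exact Or.inl (SimpleGraph.Reachable.refl _)
        · have hadj : (G.deleteEdges {s(h, l)}).Adj a c := by
            rw [SimpleGraph.deleteEdges_adj]
            exact ⟨hac, he⟩
          exact ha.imp (fun t => t.trans hadj.reachable) (fun t => t.trans hadj.reachable)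
    intro x
    obtain ⟨p⟩ := hG.connected h x
    exact key p (Or.inl (SimpleGraph.Reachable.refl _))
  have hnot : s(i, j) ∉ (G.deleteEdges {s(h, l)}).edgeSet := by
    intro hadj
    exact hj (hi.trans (SimpleGraph.Adj.reachable hadj))
  have hset : (G.deleteEdges {s(h, l)} ⊔ SimpleGraph.edge i j).edgeSet
        = insert s(i, j) (G.edgeSet \ {s(h, l)}) := by
    rw [SimpleGraph.edgeSet_sup, SimpleGraph.edgeSet_edge_of_ne hij,
      SimpleGraph.edgeSet_deleteEdges, Set.union_comm, Set.insert_eq]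
  refine ⟨?_, hnot, hset⟩
  rw [SimpleGraph.isTree_iff_connected_and_card]
  constructor
  · have hle : G.deleteEdges {s(h, l)} ≤ G.deleteEdges {s(h, l)} ⊔ SimpleGraph.edge i j :=
      le_sup_left
    have hadj : (G.deleteEdges {s(h, l)} ⊔ SimpleGraph.edge i j).Adj i j := by
      rw [← SimpleGraph.mem_edgeSet, hset]
      exact Set.mem_insert _ _
    have hlj : (G.deleteEdges {s(h, l)}).Reachable l j := (hside j).resolve_left hj
    have hl : (G.deleteEdges {s(h, l)} ⊔ SimpleGraph.edge i j).Reachable h l :=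
      ((hi.mono hle).trans hadj.reachable).trans (hlj.mono hle).symm
    have hall : ∀ x, (G.deleteEdges {s(h, l)} ⊔ SimpleGraph.edge i j).Reachable h x := fun x =>
      (hside x).elim (fun t => t.mono hle) (fun t => hl.trans (t.mono hle))
    have : Nonempty V := ⟨h⟩
    exact ⟨fun x y => (hall x).symm.trans (hall y)⟩
  -- One edge leaves and one new edge enters, so the edge count stays that of a tree.
  · have hcard := (SimpleGraph.isTree_iff_connected_and_card.1 hG).2
    rw [← hcard, hset, Nat.card_coe_set_eq, Nat.card_coe_set_eq, Set.ncard_insert_of_notMem,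
      Set.ncard_sdiff_singleton_add_one]
    · exact hhl
    · rwa [SimpleGraph.edgeSet_deleteEdges] at hnot

open Classical in
/-- If every non-edge `s(h, l)` of a tree `T` is strictly heavier than each edge of `T` on the path
from `h` to `l`, then `T` is the unique minimum spanning tree. -/
theorem isMinSpanningTree_iff_eq {d : ℕ} {T : SimpleGraph (Fin d)} (hT : T.IsTree)
    (w : Fin d → Fin d → ℝ) (hw : ∀ i j, w i j = w j i)
    (hlt : ∀ (h l i j : Fin d) (p : T.Walk h l), p.IsPath → s(i, j) ∈ p.edges →
      s(i, j) ≠ s(h, l) → w i j < w h l) (G : SimpleGraph (Fin d)) :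
    IsMinSpanningTree w G ↔ G = T := by
  have key : ∀ G, IsMinSpanningTree w G → G = T := by
    rintro G ⟨hG, hmin⟩
    by_contra hne
    have hnle : ¬ G ≤ T := by
      intro hle
      exact hne (le_antisymm hle
        ((SimpleGraph.isTree_iff_minimal_connected.1 hT).2 hG.connected hle))
    obtain ⟨h, l, hGhl, hThl⟩ : ∃ h l, G.Adj h l ∧ ¬ T.Adj h l := by
      by_contra hcon
      push Not at hcon
      exact hnle fun a b hab => hcon a b hab
    obtain ⟨p, hp⟩ := hT.connected.exists_isPath h l
    have hbr : ¬ (G.deleteEdges {s(h, l)}).Reachable h l :=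
      SimpleGraph.isBridge_iff.1
        (SimpleGraph.isAcyclic_iff_forall_adj_isBridge.1 hG.isAcyclic hGhl)
    -- Removing `s(h, l)` separates `h` from `l` in `G`, so the path from `h` to `l` in `T` must
    -- cross between the two sides. The crossing edge is lighter and reconnects `G`.
    obtain ⟨e, he, hi, hj⟩ := p.exists_boundary_dart
      {x | (G.deleteEdges {s(h, l)}).Reachable h x} (SimpleGraph.Reachable.refl _) hbr
    have hTe : T.Adj e.fst e.snd := e.adj
    have hmem : s(e.fst, e.snd) ∈ p.edges := List.mem_map_of_mem he
    have hne' : s(e.fst, e.snd) ≠ s(h, l) := by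
      intro heq
      apply hThl
      rw [← SimpleGraph.mem_edgeSet, ← heq]
      exact hTe
    have hwlt := hlt h l _ _ p hp hmem hne'
    obtain ⟨htree, hnot, hset⟩ := isTree_exchange hG hGhl hi hj
    generalize G.deleteEdges {s(h, l)} ⊔ SimpleGraph.edge e.fst e.snd = G' at htree hset
    have hle := hmin _ htree
    rw [totalWeight_eq_sum_edgeFinset w hw, totalWeight_eq_sum_edgeFinset w hw] at hle
    have hfin : G'.edgeFinset = insert s(e.fst, e.snd) (G.edgeFinset.erase s(h, l)) := by
      ext x
      rw [SimpleGraph.mem_edgeFinset, hset]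
      simp [and_comm]
    have hin : s(h, l) ∈ G.edgeFinset := by simpa using hGhl
    rw [hfin, Finset.sum_insert, ← Finset.add_sum_erase _ _ hin] at hle
    · simp only [Sym2.lift_mk] at hle
      linarith
    · rw [SimpleGraph.edgeSet_deleteEdges] at hnot
      simpa [and_comm] using hnot
  refine ⟨key G, ?_⟩
  rintro rfl
  -- Minimality of `T` comes from uniqueness: a minimizer exists among finitely many trees, and it
  -- has to be `T`.
  obtain ⟨G₀, hG₀, hmin⟩ := Set.exists_min_image {G' : SimpleGraph (Fin d) | G'.IsTree}
    (totalWeight w) (Set.toFinite _) ⟨G, hT⟩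
  have h₀ : IsMinSpanningTree w G₀ := ⟨hG₀, hmin⟩
  rwa [key G₀ h₀] at h₀

end MinimumSpanningTree

end LevyTree
namespace LevyTree

/-! ### Joint exceedances are determined by the dependence structure -/

section DependenceStructure

variable {d : ℕ}

theorem orthant_or (x : E d) : ∃ s : Fin d → ℤˣ, x ∈ orthant s := by
  classical
  refine ⟨fun i => if 0 ≤ x i then 1 else -1, fun i => ?_⟩
  by_cases h : 0 ≤ x i
  · rcases h.eq_or_lt with h0 | h0
    · exact Or.inr ⟨h0.symm, by simp [h]⟩
    · exact Or.inl (by simpa [sgn, h] using h0)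
  · exact Or.inl (by simpa [sgn, h] using not_le.1 h)

theorem sgn_eq_one {s : Fin d → ℤˣ} {i : Fin d} (h : s i = 1) : sgn s i = 1 := by
  simp [sgn, h]

theorem sgn_eq_neg_one {s : Fin d → ℤˣ} {i : Fin d} (h : s i = -1) : sgn s i = -1 := by
  simp [sgn, h]

theorem pairwise_disjoint_orthant : Pairwise (Function.onFun Disjoint (orthant (d := d))) := by
  intro s t hst
  rw [Function.onFun, Set.disjoint_left]
  intro x hs ht
  apply hst
  funext i
  have h1 := hs i
  have h2 := ht i
  rcases Int.units_eq_one_or (s i) with hi | hi <;> rcases Int.units_eq_one_or (t i) with hj | hj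
  · rw [hi, hj]
  · simp only [sgn_eq_one hi, sgn_eq_neg_one hj, hj] at h1 h2
    exfalso
    rcases h1 with h1 | h1 <;> rcases h2 with h2 | h2
    · linarith
    · exact absurd h2.2 (by decide)
    · linarith [h1.1]
    · exact absurd h2.2 (by decide)
  · simp only [sgn_eq_neg_one hi, sgn_eq_one hj, hi] at h1 h2
    exfalso
    rcases h1 with h1 | h1 <;> rcases h2 with h2 | h2
    · linarith
    · linarith [h2.1]
    · exact absurd h1.2 (by decide)
    · exact absurd h1.2 (by decide)
  · rw [hi, hj]

theorem measurableSet_orthant (s : Fin d → ℤˣ) : MeasurableSet (orthant s) := by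
  have : orthant s = ⋂ i, ({x : E d | 0 < sgn s i * x i} ∪ {x : E d | x i = 0 ∧ s i = 1}) := by
    ext x
    simp [orthant]
  rw [this]
  refine MeasurableSet.iInter fun i => ?_
  have hm : Measurable fun x : E d => x i := by fun_prop
  refine MeasurableSet.union (measurableSet_lt measurable_const (hm.const_mul _)) ?_
  exact (measurableSet_eq_fun hm measurable_const).inter (MeasurableSet.const _)

/-- Two measures that agree on the translated orthants `{y | t ≤ s y}`, with `t i > 0` or
(`t i = 0` and `s i = 1`), agree on the sets `{y | 1 < |y k| for k ∈ K}`. -/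
theorem measure_abs_gt_eq_of_orthants {μ ν : Measure (E d)}
    (h : ∀ (s : Fin d → ℤˣ) (t : Fin d → ℝ), (∀ i, 0 < t i ∨ (t i = 0 ∧ s i = 1)) →
      μ {y | ∀ i, t i ≤ sgn s i * y i} = ν {y | ∀ i, t i ≤ sgn s i * y i})
    (K : Set (Fin d)) :
    μ {y | ∀ k ∈ K, 1 < |y k|} = ν {y | ∀ k ∈ K, 1 < |y k|} := by
  classical
  set A : Set (E d) := {y | ∀ k ∈ K, 1 < |y k|} with hA
  have hAm : MeasurableSet A := by
    have : A = ⋂ k, ⋂ (_ : k ∈ K), {y : E d | 1 < |y k|} := by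
      ext y
      simp [hA]
    rw [this]
    refine MeasurableSet.iInter fun k => MeasurableSet.iInter fun _ => ?_
    have hm : Measurable fun x : E d => |x k| := by fun_prop
    exact measurableSet_lt measurable_const hm
  have hdec : ∀ ρ : Measure (E d), ρ A = ∑ s : Fin d → ℤˣ, ρ (A ∩ orthant s) := by
    intro ρ
    have : A = ⋃ s : Fin d → ℤˣ, A ∩ orthant s := by
      rw [← Set.inter_iUnion]
      refine (Set.inter_eq_left.2 fun x _ => ?_).symm
      obtain ⟨s, hs⟩ := orthant_or x
      exact Set.mem_iUnion.2 ⟨s, hs⟩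
    conv_lhs => rw [this]
    rw [measure_iUnion, tsum_fintype]
    · intro s t hst
      exact (pairwise_disjoint_orthant hst).mono Set.inter_subset_right Set.inter_subset_right
    · exact fun s => hAm.inter (measurableSet_orthant s)
  rw [hdec, hdec]
  refine Finset.sum_congr rfl fun s _ => ?_
  -- The exceedance set inside one orthant is exhausted by closed translated orthants. The margin `1
  -- / (n + 1)` turns strict inequalities into weak ones. A free coordinate with positive sign gets
  -- threshold `0`, since the face `x k = 0` belongs to that orthant.
  set t : ℕ → Fin d → ℝ := fun n k =>
    if k ∈ K then 1 + 1 / ((n : ℝ) + 1) else if s k = 1 then 0 else 1 / ((n : ℝ) + 1) with ht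
  have hpos : ∀ n : ℕ, (0 : ℝ) < 1 / ((n : ℝ) + 1) := fun n => Nat.one_div_pos_of_nat
  have hanti : ∀ k, Antitone fun n => t n k := by
    intro k n m hnm
    have := Nat.one_div_le_one_div (α := ℝ) hnm
    simp only [ht]
    split_ifs <;> linarith
  have hU : A ∩ orthant s = ⋃ n, {y : E d | ∀ i, t n i ≤ sgn s i * y i} := by
    ext y
    simp only [Set.mem_inter_iff, Set.mem_iUnion, Set.mem_ofPred_eq]
    constructor
    · rintro ⟨hyA, hyO⟩
      have hev : ∀ i, ∀ᶠ n in atTop, t n i ≤ sgn s i * y i := by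
        intro i
        have hlim : Tendsto (fun n : ℕ => 1 / ((n : ℝ) + 1)) atTop (𝓝 0) :=
          tendsto_one_div_add_atTop_nhds_zero_nat
        have habs : ∀ r : ℝ, |sgn s i * r| = |r| := by
          intro r
          rcases Int.units_eq_one_or (s i) with hi | hi
          · simp [sgn_eq_one hi]
          · simp [sgn_eq_neg_one hi]
        have hnn : 0 ≤ sgn s i * y i := by
          rcases hyO i with h1 | h1
          · exact h1.le
          · simp [h1.1]
        by_cases hk : i ∈ K
        · have h1 : 1 < sgn s i * y i := by
            have := hyA i hk
            rwa [← habs, abs_of_nonneg hnn] at this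
          have : ∀ᶠ n : ℕ in atTop, 1 / ((n : ℝ) + 1) < sgn s i * y i - 1 :=
            hlim.eventually_lt_const (by linarith)
          filter_upwards [this] with n hn
          simp only [ht, if_pos hk]
          linarith
        · by_cases hs1 : s i = 1
          · simp [ht, hk, hs1, hnn]
          · have h1 : 0 < sgn s i * y i := (hyO i).resolve_right fun h => hs1 h.2
            have : ∀ᶠ n : ℕ in atTop, 1 / ((n : ℝ) + 1) < sgn s i * y i :=
              hlim.eventually_lt_const h1
            filter_upwards [this] with n hn
            simp only [ht, if_neg hk, if_neg hs1]
            exact hn.le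
      exact (eventually_all.2 hev).exists
    · rintro ⟨n, hn⟩
      constructor
      · intro k hk
        have h1 := hn k
        simp only [ht, if_pos hk] at h1
        have h2 := hpos n
        rcases Int.units_eq_one_or (s k) with hi | hi
        · rw [sgn_eq_one hi] at h1
          exact lt_of_lt_of_le (by linarith) (le_abs_self _)
        · rw [sgn_eq_neg_one hi] at h1
          exact lt_of_lt_of_le (by linarith) (neg_le_abs _)
      · intro i
        have h1 := hn i
        have h2 := hpos n
        by_cases hk : i ∈ K
        · simp only [ht, if_pos hk] at h1
          exact Or.inl (by linarith)
        · by_cases hs1 : s i = 1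
          · simp only [ht, if_neg hk, if_pos hs1, sgn_eq_one hs1, one_mul] at h1
            rcases h1.eq_or_lt with h0 | h0
            · exact Or.inr ⟨h0.symm, hs1⟩
            · exact Or.inl (by simpa [sgn_eq_one hs1] using h0)
          · simp only [ht, if_neg hk, if_neg hs1] at h1
            exact Or.inl (by linarith)
  have hmono : Monotone fun n => {y : E d | ∀ i, t n i ≤ sgn s i * y i} :=
    fun n m hnm y hy i => (hanti i hnm).trans (hy i)
  rw [hU, hmono.measure_iUnion, hmono.measure_iUnion]
  refine iSup_congr fun n => h s (t n) fun i => ?_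
  have h2 := hpos n
  by_cases hk : i ∈ K
  · exact Or.inl (by simp only [ht, if_pos hk]; linarith)
  · by_cases hs1 : s i = 1
    · exact Or.inr ⟨by simp [ht, hk, hs1], hs1⟩
    · exact Or.inl (by simpa only [ht, if_neg hk, if_neg hs1] using h2)

/-- If the marginal tails of `Λ` are power functions, two measures that carry the dependence
structure of `Λ` agree on the sets `{y | 1 < |y k| for k ∈ K}`. -/
theorem measure_abs_gt_eq_of_sameDependence {Λ μ ν : Measure (E d)} {cpos cneg α : Fin d → ℝ}
    (hc : ∀ i, 0 < cpos i ∧ 0 < cneg i ∧ α i ∈ Set.Ioo (0 : ℝ) 2)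
    (htail : ∀ i, ∀ x : ℝ, 0 < x →
      tail Λ i x = ENNReal.ofReal (cpos i * x ^ (-α i)) ∧
      tail Λ i (-x) = ENNReal.ofReal (cneg i * x ^ (-α i)))
    (hμ : SameDependence Λ μ) (hν : SameDependence Λ ν) (K : Set (Fin d)) :
    μ {y | ∀ k ∈ K, 1 < |y k|} = ν {y | ∀ k ∈ K, 1 < |y k|} := by
  refine measure_abs_gt_eq_of_orthants (fun s t hst => ?_) K
  -- The tail `c x^(-a)` equals `1 / t` at `x = (c t)^(1/a)`, so every positive threshold is some `1
  -- / U_i(x)`.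
  have hinv : ∀ c a t : ℝ, 0 < c → 0 < a → 0 < t →
      (ENNReal.ofReal (c * ((c * t) ^ a⁻¹) ^ (-a)))⁻¹ = ENNReal.ofReal t := by
    intro c a t hc ha ht
    have h1 : ((c * t) ^ a⁻¹) ^ (-a) = (c * t)⁻¹ := by
      rw [← Real.rpow_mul (by positivity)]
      have : a⁻¹ * -a = -1 := by field_simp
      rw [this, Real.rpow_neg_one]
    rw [h1, ← ENNReal.ofReal_inv_of_pos (by positivity)]
    congr 1
    field_simp
  -- An infinite tail at `0` makes the threshold `0` available too, at `x = 0`.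
  have htop : ∀ i, tail Λ i 0 = ∞ := by
    intro i
    have hle : ∀ x : ℝ, 0 < x → tail Λ i x ≤ tail Λ i 0 := by
      intro x hx
      rw [tail, tail, if_pos hx.le, if_pos le_rfl]
      exact measure_mono fun y hy => ⟨hy.1, hx.le.trans hy.2⟩
    have hz : ∀ u : ℝ, 0 < u → (tail Λ i 0)⁻¹ ≤ ENNReal.ofReal u := by
      intro u hu
      have h1 : 0 < (cpos i * u) ^ (α i)⁻¹ := Real.rpow_pos_of_pos (mul_pos (hc i).1 hu) _
      have := ENNReal.inv_le_inv.2 (hle _ h1)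
      rwa [(htail i _ h1).1, hinv _ _ _ (hc i).1 (hc i).2.2.1 hu] at this
    have : (tail Λ i 0)⁻¹ = 0 := by
      by_contra hne
      obtain ⟨r, hr0, hr⟩ := ENNReal.lt_iff_exists_nnreal_btwn.1 (pos_iff_ne_zero.2 hne)
      have h1 := hz r (by exact_mod_cast hr0)
      rw [ENNReal.ofReal_coe_nnreal] at h1
      exact absurd hr (not_lt.2 h1)
    exact ENNReal.inv_eq_zero.1 this
  have hchoice : ∀ i, ∃ x : ℝ, (0 < sgn s i * x ∨ (x = 0 ∧ s i = 1)) ∧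
      (tail Λ i x)⁻¹ = ENNReal.ofReal (t i) := by
    intro i
    rcases hst i with hti | ⟨hti, hsi⟩
    · rcases Int.units_eq_one_or (s i) with hi | hi
      · have h1 : 0 < (cpos i * t i) ^ (α i)⁻¹ := Real.rpow_pos_of_pos (mul_pos (hc i).1 hti) _
        refine ⟨_, Or.inl (by simpa [sgn_eq_one hi] using h1), ?_⟩
        rw [(htail i _ h1).1, hinv _ _ _ (hc i).1 (hc i).2.2.1 hti]
      · have h1 : 0 < (cneg i * t i) ^ (α i)⁻¹ := Real.rpow_pos_of_pos (mul_pos (hc i).2.1 hti) _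
        refine ⟨-(cneg i * t i) ^ (α i)⁻¹, Or.inl (by simpa [sgn_eq_neg_one hi] using h1), ?_⟩
        rw [(htail i _ h1).2, hinv _ _ _ (hc i).2.1 (hc i).2.2.1 hti]
    · exact ⟨0, Or.inr ⟨rfl, hsi⟩, by simp [htop, hti]⟩
  choose x hx hxt using hchoice
  have htnn : ∀ i, 0 ≤ t i := fun i => (hst i).elim le_of_lt fun h => h.1.ge
  have hset : {y : E d | ∀ i, (((tail Λ i (x i))⁻¹ : ℝ≥0∞) : EReal) ≤ ((sgn s i * y i : ℝ) : EReal)}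
      = {y | ∀ i, t i ≤ sgn s i * y i} := by
    ext y
    simp only [Set.mem_ofPred_eq]
    refine forall_congr' fun i => ?_
    rw [hxt i, EReal.coe_ennreal_ofReal, max_eq_left (htnn i), EReal.coe_le_coe_iff]
  have h1 := hμ s (WithLp.toLp 2 x) (fun i => hx i)
  have h2 := hν s (WithLp.toLp 2 x) (fun i => hx i)
  simp only at h1 h2
  rw [hset] at h1 h2
  rw [← h1, h2]

end DependenceStructure

end LevyTree
namespace LevyTree

/-! ### From homogeneous measures to exactly homogeneous densities -/

section Homogeneous

theorem lintegral_comp_mul_left {c : ℝ} (hc : c ≠ 0) (f : ℝ → ℝ≥0∞) :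
    ∫⁻ x, f (c * x) = ENNReal.ofReal |c⁻¹| * ∫⁻ x, f x := by
  have h := lintegral_map_equiv (μ := volume) f (MeasurableEquiv.mulLeft₀ c hc)
  have h2 : (⇑(MeasurableEquiv.mulLeft₀ c hc) : ℝ → ℝ) = fun x => c * x := rfl
  rw [h2, Real.map_volume_mul_left hc, lintegral_smul_measure] at h
  exact h.symm

theorem quasiMeasurePreserving_mul_left {c : ℝ} (hc : c ≠ 0) :
    Measure.QuasiMeasurePreserving (fun x : ℝ => c * x) volume volume := by
  refine ⟨by fun_prop, ?_⟩
  rw [Real.map_volume_mul_left hc]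
  exact Measure.smul_absolutelyContinuous

theorem lintegral_Ioi_one_div_sq :
    ∫⁻ x in Set.Ioi (1 : ℝ), ENNReal.ofReal (1 / x ^ 2) = 1 := by
  have hcongr : Set.EqOn (fun x : ℝ => x ^ (-2 : ℝ)) (fun x => 1 / x ^ 2) (Set.Ioi 1) := by
    intro x hx
    have hx0 : (0 : ℝ) < x := lt_trans one_pos hx
    simp only
    rw [Real.rpow_neg hx0.le, one_div]
    norm_cast
  have hint : IntegrableOn (fun x : ℝ => 1 / x ^ 2) (Set.Ioi 1) :=
    (integrableOn_Ioi_rpow_of_lt (by norm_num : (-2 : ℝ) < -1) one_pos).congr_fun hcongr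
      measurableSet_Ioi
  have hval : ∫ x in Set.Ioi (1 : ℝ), 1 / x ^ 2 = 1 := by
    rw [← setIntegral_congr_fun measurableSet_Ioi hcongr,
      integral_Ioi_rpow_of_lt (by norm_num : (-2 : ℝ) < -1) one_pos]
    norm_num
  rw [← ofReal_integral_eq_lintegral_ofReal hint
    (Eventually.of_forall fun x => by simp only [Pi.zero_apply]; positivity), hval,
    ENNReal.ofReal_one]

/-- A density on the plane that is homogeneous of degree `-3`, vanishes for `a ≤ 0` and has mass `1`
on `{1 < a}` has marginal density `a⁻²`. -/
theorem lintegral_right_of_homogeneous {f : ℝ × ℝ → ℝ≥0∞} (hf : Measurable f)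
    (hhom : ∀ t : ℝ, 0 < t → ∀ a b, ENNReal.ofReal (t ^ 3) * f (t * a, t * b) = f (a, b))
    (hmass : ∫⁻ y in {y : ℝ × ℝ | 1 < y.1}, f y = 1) {a : ℝ} (ha : 0 < a) :
    ∫⁻ b, f (a, b) = ENNReal.ofReal (1 / a ^ 2) := by
  have hscale : ∀ a : ℝ, 0 < a →
      ∫⁻ b, f (a, b) = ENNReal.ofReal (1 / a ^ 2) * ∫⁻ b, f (1, b) := by
    intro a ha
    have h1 := lintegral_comp_mul_left ha.ne' fun b => f (a, b)
    have h2 : ∀ b, ENNReal.ofReal (a ^ 3) * f (a, a * b) = f (1, b) := by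
      intro b
      simpa using hhom a ha 1 b
    have h3 : ∫⁻ b, f (1, b) = ENNReal.ofReal (a ^ 3) * ∫⁻ b, f (a, a * b) := by
      rw [← lintegral_const_mul' _ _ ENNReal.ofReal_ne_top]
      exact lintegral_congr fun b => (h2 b).symm
    rw [h3, h1, ← mul_assoc, ← mul_assoc, ← ENNReal.ofReal_mul (by positivity),
      ← ENNReal.ofReal_mul (by positivity), abs_of_pos (by positivity)]
    have : 1 / a ^ 2 * a ^ 3 * a⁻¹ = 1 := by field_simp
    rw [this, ENNReal.ofReal_one, one_mul]
  -- By scaling, the marginal is a constant times `a⁻²`; the mass `1` on `{1 < a}` fixes the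
  -- constant.
  have hone : ∫⁻ b, f (1, b) = 1 := by
    have hset : {y : ℝ × ℝ | 1 < y.1} = Set.Ioi 1 ×ˢ Set.univ := by
      ext y
      simp
    rw [hset, Measure.volume_eq_prod, setLIntegral_prod _ hf.aemeasurable] at hmass
    simp only [Measure.restrict_univ] at hmass
    rw [setLIntegral_congr_fun measurableSet_Ioi
      (fun a ha => hscale a (lt_trans one_pos ha)), lintegral_mul_const _ (by fun_prop),
      lintegral_Ioi_one_div_sq, one_mul] at hmass
    exact hmass
  rw [hscale a ha, hone, mul_one]

/-- Scaling the measure by `h` gives a factor `h⁻¹` and the Jacobian in the plane is `h²`, whence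
the exponent `3`. The exceptional null set depends on `h`. -/
theorem IsPositiveModel.ae_homogeneous {g : ℝ × ℝ → ℝ≥0∞} (hg : IsPositiveModel g) {h : ℝ}
    (hh : 0 < h) : ∀ᵐ y : ℝ × ℝ, ENNReal.ofReal (h ^ 3) * g (h • y) = g y := by
  have hgm := hg.measurable
  have hm : Measurable fun y : ℝ × ℝ => ENNReal.ofReal (h ^ 3) * g (h • y) := by fun_prop
  refine (withDensity_eq_iff_of_sigmaFinite hm.aemeasurable hgm.aemeasurable).1 ?_
  ext A hA
  have hhom := hg.homogeneous h hh A hA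
  set e : ℝ × ℝ ≃ᵐ ℝ × ℝ := MeasurableEquiv.smul₀ h hh.ne' with he
  have hecoe : (⇑e : ℝ × ℝ → ℝ × ℝ) = fun y => h • y := rfl
  have himg : MeasurableSet ((fun y : ℝ × ℝ => h • y) '' A) := by
    rw [← hecoe]
    exact e.measurableSet_image.2 hA
  rw [withDensity_apply _ himg, withDensity_apply _ hA] at hhom
  rw [withDensity_apply _ hA, withDensity_apply _ hA, lintegral_const_mul _ (by fun_prop)]
  have hmap := lintegral_map_equiv (μ := (volume : Measure (ℝ × ℝ)))
    (((fun y : ℝ × ℝ => h • y) '' A).indicator g) e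
  rw [hecoe, Measure.map_addHaar_smul _ hh.ne', lintegral_smul_measure, lintegral_indicator himg,
    hhom] at hmap
  have hind : ∀ y : ℝ × ℝ, ((fun y : ℝ × ℝ => h • y) '' A).indicator g (h • y)
      = A.indicator (fun y => g (h • y)) y := by
    intro y
    have hiff : h • y ∈ (fun y : ℝ × ℝ => h • y) '' A ↔ y ∈ A := by
      rw [← hecoe]
      exact e.injective.mem_set_image
    by_cases hy : y ∈ A
    · rw [Set.indicator_of_mem (hiff.2 hy), Set.indicator_of_mem hy]
    · rw [Set.indicator_of_notMem (fun h => hy (hiff.1 h)), Set.indicator_of_notMem hy]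
  simp only [hind] at hmap
  rw [lintegral_indicator hA] at hmap
  rw [← hmap, smul_eq_mul, ← mul_assoc, ← mul_assoc, ← ENNReal.ofReal_mul (by positivity),
    ← ENNReal.ofReal_mul (by positivity)]
  have hfr : Module.finrank ℝ (ℝ × ℝ) = 2 := by simp
  have : h ^ 3 * |(h ^ Module.finrank ℝ (ℝ × ℝ))⁻¹| * h⁻¹ = 1 := by
    rw [hfr, abs_of_pos (by positivity)]
    field_simp
  rw [this, ENNReal.ofReal_one, one_mul]

/-- A positive model factorizes almost everywhere through the ratio of the coordinates. -/
theorem IsPositiveModel.exists_ratio_density {g : ℝ × ℝ → ℝ≥0∞} (hg : IsPositiveModel g) :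
    ∃ q : ℝ → ℝ≥0∞, Measurable q ∧
      ∀ᵐ y : ℝ × ℝ, 0 < y.1 → ENNReal.ofReal (y.1 ^ 3) * g y = q (y.1⁻¹ * y.2) := by
  have hgm := hg.measurable
  -- In the coordinates (first entry, ratio), homogeneity says that `G` does not depend on its first
  -- argument.
  set G : ℝ × ℝ → ℝ≥0∞ := fun z => ENNReal.ofReal (z.1 ^ 3) * g (z.1, z.1 * z.2) with hG
  have hGm : Measurable G := by fun_prop
  have hmeas : MeasurableSet {x : ℝ × (ℝ × ℝ) |
      0 < x.1 → 0 < x.2.1 → G (x.1 * x.2.1, x.2.2) = G x.2} := by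
    have h1 : MeasurableSet {x : ℝ × (ℝ × ℝ) | 0 < x.1} :=
      measurableSet_lt measurable_const (by fun_prop)
    have h2 : MeasurableSet {x : ℝ × (ℝ × ℝ) | 0 < x.2.1} :=
      measurableSet_lt measurable_const (by fun_prop)
    have h3 : MeasurableSet {x : ℝ × (ℝ × ℝ) | G (x.1 * x.2.1, x.2.2) = G x.2} :=
      measurableSet_eq_fun (by fun_prop) (by fun_prop)
    exact h1.imp (h2.imp h3)
  have hstep : ∀ᵐ h : ℝ, ∀ᵐ z : ℝ × ℝ, 0 < h → 0 < z.1 → G (h * z.1, z.2) = G z := by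
    refine Eventually.of_forall fun h => ?_
    by_cases hh : 0 < h
    swap
    · exact Eventually.of_forall fun z hz => absurd hz hh
    have h1 := Measure.ae_ae_of_ae_prod (hg.ae_homogeneous hh)
    have hms : MeasurableSet {z : ℝ × ℝ | 0 < h → 0 < z.1 → G (h * z.1, z.2) = G z} :=
      hmeas.preimage (measurable_prodMk_left (x := h))
    rw [Measure.volume_eq_prod, Measure.ae_prod_iff_ae_ae hms]
    filter_upwards [h1] with a ha
    by_cases ha0 : 0 < a
    swap
    · exact Eventually.of_forall fun w _ hz => absurd hz ha0
    filter_upwards [(quasiMeasurePreserving_mul_left ha0.ne').ae ha] with w hw _ _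
    simp only [hG]
    simp only [Prod.smul_mk, smul_eq_mul] at hw
    rw [← hw, mul_pow, ENNReal.ofReal_mul (by positivity), mul_assoc h a w]
    ring
  -- Fubini exchanges the quantifiers "every `h`, almost every `z`". One good `a₀ > 0` can then be
  -- frozen, and `G (a₀, ·)` serves as the ratio density.
  rw [Measure.ae_ae_comm (p := fun (h : ℝ) (z : ℝ × ℝ) =>
    0 < h → 0 < z.1 → G (h * z.1, z.2) = G z) hmeas, Measure.volume_eq_prod] at hstep
  have h2 := Measure.ae_ae_of_ae_prod hstep
  obtain ⟨a₀, ha₀, hq⟩ : ∃ a₀ : ℝ, 0 < a₀ ∧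
      ∀ᵐ w : ℝ, ∀ᵐ h : ℝ, 0 < h → G (h * a₀, w) = G (a₀, w) := by
    have hne : ∃ᵐ a : ℝ, 0 < a := by
      rw [frequently_ae_iff]
      have : {a : ℝ | 0 < a} = Set.Ioi 0 := rfl
      rw [this, Real.volume_Ioi]
      exact ENNReal.top_ne_zero
    obtain ⟨a₀, ha₀, h3⟩ := (hne.and_eventually h2).exists
    refine ⟨a₀, ha₀, ?_⟩
    filter_upwards [h3] with w hw
    filter_upwards [hw] with h hh hpos
    exact hh hpos ha₀
  refine ⟨fun w => G (a₀, w), by fun_prop, ?_⟩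
  have hm2 : MeasurableSet {x : ℝ × ℝ | 0 < x.2 → G (x.2 * a₀, x.1) = G (a₀, x.1)} := by
    have h1 : MeasurableSet {x : ℝ × ℝ | 0 < x.2} :=
      measurableSet_lt measurable_const (by fun_prop)
    exact h1.imp (measurableSet_eq_fun (by fun_prop) (by fun_prop))
  rw [Measure.ae_ae_comm (p := fun (w : ℝ) (h : ℝ) => 0 < h → G (h * a₀, w) = G (a₀, w)) hm2] at hq
  have hm3 : MeasurableSet {y : ℝ × ℝ | 0 < y.1 →
      ENNReal.ofReal (y.1 ^ 3) * g y = G (a₀, y.1⁻¹ * y.2)} := by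
    have h1 : MeasurableSet {x : ℝ × ℝ | 0 < x.1} :=
      measurableSet_lt measurable_const (by fun_prop)
    exact h1.imp (measurableSet_eq_fun (by fun_prop) (by fun_prop))
  rw [Measure.volume_eq_prod, Measure.ae_prod_iff_ae_ae hm3]
  filter_upwards [(quasiMeasurePreserving_mul_left (inv_ne_zero ha₀.ne')).ae hq] with a ha
  by_cases ha0 : 0 < a
  swap
  · exact Eventually.of_forall fun w hz => absurd hz ha0
  filter_upwards [(quasiMeasurePreserving_mul_left (inv_ne_zero ha0.ne')).ae ha] with b hb _
  have h5 := hb (by positivity)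
  rw [← h5]
  have e1 : a₀⁻¹ * a * a₀ = a := by field_simp
  have e2 : a * (a⁻¹ * b) = b := by field_simp
  simp only [hG, e1, e2]

/-- A positive model has a version that is homogeneous everywhere. -/
theorem IsPositiveModel.exists_homogeneous_version {g : ℝ × ℝ → ℝ≥0∞} (hg : IsPositiveModel g) :
    ∃ f : ℝ × ℝ → ℝ≥0∞, Measurable f ∧ f =ᵐ[volume] g ∧
      (∀ y : ℝ × ℝ, ¬ (0 < y.1 ∧ 0 < y.2) → f y = 0) ∧
      (∀ t : ℝ, 0 < t → ∀ a b, ENNReal.ofReal (t ^ 3) * f (t * a, t * b) = f (a, b)) ∧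
      (∀ a : ℝ, 0 < a → ∫⁻ b, f (a, b) = ENNReal.ofReal (1 / a ^ 2)) ∧
      (∀ b : ℝ, 0 < b → ∫⁻ a, f (a, b) = ENNReal.ofReal (1 / b ^ 2)) := by
  obtain ⟨q, hqm, hq⟩ := hg.exists_ratio_density
  set S : Set (ℝ × ℝ) := {y | 0 < y.1 ∧ 0 < y.2} with hS
  have hSm : MeasurableSet S := by
    have h1 : MeasurableSet {y : ℝ × ℝ | 0 < y.1} :=
      measurableSet_lt measurable_const (by fun_prop)
    have h2 : MeasurableSet {y : ℝ × ℝ | 0 < y.2} :=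
      measurableSet_lt measurable_const (by fun_prop)
    exact h1.inter h2
  set f : ℝ × ℝ → ℝ≥0∞ :=
    S.indicator fun y => ENNReal.ofReal ((y.1 ^ 3)⁻¹) * q (y.1⁻¹ * y.2) with hf
  have hfm : Measurable f := Measurable.indicator (by fun_prop) hSm
  have hfg : f =ᵐ[volume] g := by
    filter_upwards [hq] with y hy
    by_cases hyS : y ∈ S
    · have h1 : 0 < y.1 := hyS.1
      rw [hf, Set.indicator_of_mem hyS, ← hy h1, ← mul_assoc,
        ← ENNReal.ofReal_mul (by positivity), inv_mul_cancel₀ (by positivity), ENNReal.ofReal_one,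
        one_mul]
    · rw [hf, Set.indicator_of_notMem hyS, hg.support y hyS]
  have hhom : ∀ t : ℝ, 0 < t → ∀ a b, ENNReal.ofReal (t ^ 3) * f (t * a, t * b) = f (a, b) := by
    intro t ht a b
    by_cases hy : (a, b) ∈ S
    · have ha : 0 < a := hy.1
      have hb : 0 < b := hy.2
      have hy' : (t * a, t * b) ∈ S := ⟨mul_pos ht ha, mul_pos ht hb⟩
      rw [hf, Set.indicator_of_mem hy, Set.indicator_of_mem hy', ← mul_assoc,
        ← ENNReal.ofReal_mul (by positivity)]
      congr 2
      · simp only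
        field_simp
      · simp only
        field_simp
    · have hy' : (t * a, t * b) ∉ S := fun h =>
        hy ⟨pos_of_mul_pos_right h.1 ht.le, pos_of_mul_pos_right h.2 ht.le⟩
      rw [hf, Set.indicator_of_notMem hy, Set.indicator_of_notMem hy', mul_zero]
  have hmass : ∀ A : Set (ℝ × ℝ), MeasurableSet A →
      ∫⁻ y in A, f y = (volume.withDensity g) A := by
    intro A hA
    rw [withDensity_apply _ hA]
    exact lintegral_congr_ae (ae_restrict_of_ae hfg)
  refine ⟨f, hfm, hfg, fun y hy => Set.indicator_of_notMem (s := S) hy _, hhom, ?_, ?_⟩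
  · intro a ha
    refine lintegral_right_of_homogeneous hfm hhom ?_ ha
    rw [hmass _ (measurableSet_lt measurable_const (by fun_prop)), hg.margin_fst 1 one_pos]
    simp
  · intro b hb
    refine lintegral_right_of_homogeneous (f := fun y => f y.swap) (by fun_prop)
      (fun t ht a b => hhom t ht b a) ?_ hb
    have hset : MeasurableSet {y : ℝ × ℝ | 1 < y.2} :=
      measurableSet_lt measurable_const (by fun_prop)
    have h1 := hmass _ hset
    rw [hg.margin_snd 1 one_pos, ← lintegral_indicator hset] at h1
    rw [← lintegral_indicator (measurableSet_lt measurable_const (by fun_prop))]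
    have h2 := (Measure.measurePreserving_swap (μ := (volume : Measure ℝ))
      (ν := (volume : Measure ℝ))).lintegral_comp (hfm.indicator hset)
    rw [← Measure.volume_eq_prod, h1] at h2
    rw [show (1 : ℝ≥0∞) = ENNReal.ofReal (1 / 1) by simp, ← h2]
    rfl

end Homogeneous

end LevyTree
namespace LevyTree

/-! ### Edge kernels, their Markov operators and the bathtub inequality -/

section EdgeKernel

theorem marginDensity_ne_top (a : ℝ) : marginDensity a ≠ ∞ := ENNReal.ofReal_ne_top

theorem marginDensity_zero : marginDensity 0 = 0 := by simp [marginDensity]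

theorem marginDensity_ne_zero {a : ℝ} (ha : a ≠ 0) : marginDensity a ≠ 0 := by
  rw [marginDensity, Ne, ENNReal.ofReal_eq_zero, not_le]
  positivity

theorem marginDensity_neg (a : ℝ) : marginDensity (-a) = marginDensity a := by
  simp [marginDensity]

theorem marginDensity_mul {t : ℝ} (ht : 0 < t) (a : ℝ) :
    marginDensity a = ENNReal.ofReal (t ^ 2) * marginDensity (t * a) := by
  rw [marginDensity, marginDensity, ← ENNReal.ofReal_mul (by positivity)]
  congr 1
  field_simp

@[fun_prop]
theorem measurable_marginDensity : Measurable marginDensity := by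
  unfold marginDensity
  fun_prop

/-- A bivariate Lévy density on the plane that is homogeneous, even, and has standardized
margins. -/
structure IsEdgeKernel (f : ℝ → ℝ → ℝ≥0∞) : Prop where
  measurable : Measurable fun y : ℝ × ℝ => f y.1 y.2
  neg_neg : ∀ a b, f (-a) (-b) = f a b
  homogeneous : ∀ t : ℝ, 0 < t → ∀ a b, ENNReal.ofReal (t ^ 3) * f (t * a) (t * b) = f a b
  zero_left : ∀ b, f 0 b = 0
  zero_right : ∀ a, f a 0 = 0
  lintegral_left : ∀ a, a ≠ 0 → ∫⁻ b, f a b = marginDensity a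
  lintegral_right : ∀ b, b ≠ 0 → ∫⁻ a, f a b = marginDensity b

theorem IsEdgeKernel.swap {f : ℝ → ℝ → ℝ≥0∞} (hf : IsEdgeKernel f) :
    IsEdgeKernel fun a b => f b a where
  measurable := hf.measurable.comp measurable_swap
  neg_neg a b := hf.neg_neg b a
  homogeneous t ht a b := hf.homogeneous t ht b a
  zero_left := hf.zero_right
  zero_right := hf.zero_left
  lintegral_left := hf.lintegral_right
  lintegral_right := hf.lintegral_left

/-- At most one of the four reflections of `(a, b)` lies in the open positive quadrant. The case
distinction thus becomes a sum, to which measurability, scaling and integration apply termwise. -/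
theorem edgeDensity_eq_sum {f : ℝ × ℝ → ℝ≥0∞}
    (hsupp : ∀ y : ℝ × ℝ, ¬ (0 < y.1 ∧ 0 < y.2) → f y = 0) (m a b : ℝ) :
    edgeDensity m f a b = ENNReal.ofReal m * (f (a, b) + f (-a, -b))
      + ENNReal.ofReal (1 - m) * (f (a, -b) + f (-a, b)) := by
  have h0 : ∀ a b : ℝ, a ≤ 0 → f (a, b) = 0 := fun a b h => hsupp _ fun h' => absurd h'.1 h.not_gt
  have h1 : ∀ a b : ℝ, b ≤ 0 → f (a, b) = 0 := fun a b h => hsupp _ fun h' => absurd h'.2 h.not_gt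
  unfold edgeDensity
  rcases lt_trichotomy a 0 with ha | ha | ha <;> rcases lt_trichotomy b 0 with hb | hb | hb
  · rw [if_pos (mul_pos_of_neg_of_neg ha hb), abs_of_neg ha, abs_of_neg hb, h0 a b ha.le,
      h0 a _ ha.le, h1 _ b hb.le]
    simp
  · subst hb
    simp [h1]
  · rw [if_neg (mul_neg_of_neg_of_pos ha hb).le.not_gt, if_pos (mul_neg_of_neg_of_pos ha hb),
      abs_of_neg ha, abs_of_pos hb, h0 a b ha.le, h0 a _ ha.le, h1 _ (-b) (by linarith)]
    simp
  · subst ha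
    simp [h0]
  · subst ha
    simp [h0]
  · subst ha
    simp [h0]
  · rw [if_neg (mul_neg_of_pos_of_neg ha hb).le.not_gt, if_pos (mul_neg_of_pos_of_neg ha hb),
      abs_of_pos ha, abs_of_neg hb, h1 a b hb.le, h0 (-a) _ (by linarith), h1 _ b hb.le]
    simp
  · subst hb
    simp [h1]
  · rw [if_pos (mul_pos ha hb), abs_of_pos ha, abs_of_pos hb, h0 (-a) (-b) (by linarith),
      h1 a (-b) (by linarith), h0 (-a) b (by linarith)]
    simp

theorem isEdgeKernel_edgeDensity {m : ℝ} (hm : m ∈ Set.Icc (0 : ℝ) 1) {f : ℝ × ℝ → ℝ≥0∞}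
    (hfm : Measurable f) (hsupp : ∀ y : ℝ × ℝ, ¬ (0 < y.1 ∧ 0 < y.2) → f y = 0)
    (hhom : ∀ t : ℝ, 0 < t → ∀ a b, ENNReal.ofReal (t ^ 3) * f (t * a, t * b) = f (a, b))
    (hfst : ∀ a : ℝ, 0 < a → ∫⁻ b, f (a, b) = ENNReal.ofReal (1 / a ^ 2))
    (hsnd : ∀ b : ℝ, 0 < b → ∫⁻ a, f (a, b) = ENNReal.ofReal (1 / b ^ 2)) :
    IsEdgeKernel (edgeDensity m f) := by
  have heq := edgeDensity_eq_sum hsupp m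
  have h0 : ∀ a b : ℝ, a ≤ 0 → f (a, b) = 0 := fun a b h => hsupp _ fun h' => absurd h'.1 h.not_gt
  have h1 : ∀ a b : ℝ, b ≤ 0 → f (a, b) = 0 := fun a b h => hsupp _ fun h' => absurd h'.2 h.not_gt
  have hadd : ENNReal.ofReal m + ENNReal.ofReal (1 - m) = 1 := by
    rw [← ENNReal.ofReal_add hm.1 (by linarith [hm.2])]
    simp
  have hneg : ∀ a b, edgeDensity m f (-a) (-b) = edgeDensity m f a b := by
    intro a b
    simp only [heq, _root_.neg_neg]
    ring
  refine ⟨?_, hneg, ?_, ?_, ?_, ?_, ?_⟩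
  · simp only [heq]
    fun_prop
  · intro t ht a b
    simp only [heq]
    rw [← hhom t ht a b, ← hhom t ht (-a) (-b), ← hhom t ht a (-b), ← hhom t ht (-a) b]
    simp only [mul_neg]
    ring
  · intro b
    simp [edgeDensity]
  · intro a
    simp [edgeDensity]
  -- Only the terms with weights `m` and `1 - m` survive for `a > 0`. Each integrates to the margin
  -- of `f`, and the weights add to one.
  · have hpos : ∀ a : ℝ, 0 < a → ∫⁻ b, edgeDensity m f a b = marginDensity a := by
      intro a ha
      have h2 : ∀ b, edgeDensity m f a b
          = ENNReal.ofReal m * f (a, b) + ENNReal.ofReal (1 - m) * f (a, -b) := by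
        intro b
        rw [heq, h0 (-a) _ (by linarith), h0 (-a) _ (by linarith), add_zero, add_zero]
      simp only [h2]
      rw [lintegral_add_left (by fun_prop), lintegral_const_mul _ (by fun_prop),
        lintegral_const_mul _ (by fun_prop), lintegral_neg_eq_self (fun b => f (a, b)), hfst a ha,
        ← add_mul, hadd, one_mul, marginDensity]
    intro a ha
    rcases ha.lt_or_gt with ha | ha
    · rw [← marginDensity_neg, ← hpos (-a) (by linarith),
        ← lintegral_neg_eq_self (fun b => edgeDensity m f (-a) b)]
      simp only [hneg]
    · exact hpos a ha
  · have hpos : ∀ b : ℝ, 0 < b → ∫⁻ a, edgeDensity m f a b = marginDensity b := by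
      intro b hb
      have h2 : ∀ a, edgeDensity m f a b
          = ENNReal.ofReal m * f (a, b) + ENNReal.ofReal (1 - m) * f (-a, b) := by
        intro a
        rw [heq, h1 _ (-b) (by linarith), h1 _ (-b) (by linarith), add_zero, zero_add]
      simp only [h2]
      rw [lintegral_add_left (by fun_prop), lintegral_const_mul _ (by fun_prop),
        lintegral_const_mul _ (by fun_prop), lintegral_neg_eq_self (fun a => f (a, b)), hsnd b hb,
        ← add_mul, hadd, one_mul, marginDensity]
    intro b hb
    rcases hb.lt_or_gt with hb | hb
    · rw [← marginDensity_neg, ← hpos (-b) (by linarith),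
        ← lintegral_neg_eq_self (fun a => edgeDensity m f a (-b))]
      simp only [hneg]
    · exact hpos b hb

/-- The Markov operator `φ ↦ E[φ(Y_j) | Y_i = ·]` of the bivariate density `f`. -/
noncomputable def transition (f : ℝ → ℝ → ℝ≥0∞) (φ : ℝ → ℝ≥0∞) (a : ℝ) : ℝ≥0∞ :=
  (marginDensity a)⁻¹ * ∫⁻ b, f a b * φ b

/-- Functions that are nondecreasing in the absolute value of the argument. -/
def RadialMono (φ : ℝ → ℝ≥0∞) : Prop := ∀ a b : ℝ, |a| ≤ |b| → φ a ≤ φ b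

/-- The indicator of `{a | 1 < |a|}`. -/
noncomputable def exceed : ℝ → ℝ≥0∞ := Set.indicator {a | 1 < |a|} 1

variable {f : ℝ → ℝ → ℝ≥0∞} {φ ψ : ℝ → ℝ≥0∞}

theorem measurableSet_one_lt_abs : MeasurableSet {a : ℝ | 1 < |a|} :=
  measurableSet_lt measurable_const (by fun_prop)

@[fun_prop]
theorem measurable_exceed : Measurable exceed :=
  measurable_one.indicator measurableSet_one_lt_abs

theorem exceed_le_one (a : ℝ) : exceed a ≤ 1 :=
  Set.indicator_le_self' (fun _ _ => zero_le) a

theorem exceed_of_lt {a : ℝ} (h : 1 < |a|) : exceed a = 1 :=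
  Set.indicator_of_mem (s := {a : ℝ | 1 < |a|}) h _

theorem exceed_of_le {a : ℝ} (h : |a| ≤ 1) : exceed a = 0 :=
  Set.indicator_of_notMem (s := {a : ℝ | 1 < |a|}) (not_lt.2 h) _

theorem radialMono_exceed : RadialMono exceed := by
  intro a b hab
  by_cases ha : 1 < |a|
  · rw [exceed_of_lt (ha.trans_le hab)]
    exact exceed_le_one a
  · rw [exceed_of_le (not_lt.1 ha)]
    exact zero_le

theorem IsEdgeKernel.measurable_comp (hf : IsEdgeKernel f) {α : Type*} [MeasurableSpace α]
    {u v : α → ℝ} (hu : Measurable u) (hv : Measurable v) : Measurable fun x => f (u x) (v x) :=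
  hf.measurable.comp (hu.prodMk hv)

theorem IsEdgeKernel.measurable_transition (hf : IsEdgeKernel f) (hφ : Measurable φ) :
    Measurable (transition f φ) := by
  have h1 : Measurable fun a => ∫⁻ b, f a b * φ b :=
    (hf.measurable.mul (hφ.comp measurable_snd)).lintegral_prod_right'
  exact measurable_marginDensity.inv.mul h1

theorem IsEdgeKernel.transition_one (hf : IsEdgeKernel f) {a : ℝ} (ha : a ≠ 0) :
    transition f 1 a = 1 := by
  simp only [transition, Pi.one_apply, mul_one]
  rw [hf.lintegral_left a ha,
    ENNReal.inv_mul_cancel (marginDensity_ne_zero ha) (marginDensity_ne_top a)]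

/-- At `0` the factor `(marginDensity 0)⁻¹` is `∞`, but the kernel vanishes there and `∞ * 0 = 0`.
This value also respects radial monotonicity. -/
theorem IsEdgeKernel.transition_zero_right (hf : IsEdgeKernel f) : transition f φ 0 = 0 := by
  simp [transition, hf.zero_left]

theorem IsEdgeKernel.transition_le_one (hf : IsEdgeKernel f) (hφ : ∀ a, φ a ≤ 1) (a : ℝ) :
    transition f φ a ≤ 1 := by
  rcases eq_or_ne a 0 with rfl | ha
  · rw [hf.transition_zero_right]
    exact zero_le
  · rw [← hf.transition_one ha]
    unfold transition
    gcongr with b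
    exact hφ b

/-- By homogeneity, averaging `φ` from the state `t a` is averaging `φ (t ·)` from `a`, and `φ (t b)
≥ φ b` for `t ≥ 1`. Joint sign symmetry reduces all states to nonnegative ones. -/
theorem IsEdgeKernel.radialMono_transition (hf : IsEdgeKernel f) (hφ : RadialMono φ) :
    RadialMono (transition f φ) := by
  have hneg : ∀ a, transition f φ (-a) = transition f φ a := by
    intro a
    unfold transition
    rw [marginDensity_neg, ← lintegral_neg_eq_self (fun b => f (-a) b * φ b)]
    congr 1
    refine lintegral_congr fun b => ?_
    rw [hf.neg_neg, le_antisymm (hφ (-b) b (abs_neg b).le) (hφ b (-b) (abs_neg b).ge)]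
  have habs : ∀ a, transition f φ |a| = transition f φ a := by
    intro a
    rcases abs_choice a with h | h
    · rw [h]
    · rw [h, hneg]
  have hscale : ∀ t a : ℝ, 1 ≤ t → transition f φ a ≤ transition f φ (t * a) := by
    intro t a ht
    have ht0 : 0 < t := one_pos.trans_le ht
    unfold transition
    have h1 := lintegral_comp_mul_left ht0.ne' fun b => f (t * a) b * φ b
    have h2 : ∫⁻ b, f (t * a) b * φ b
        = ENNReal.ofReal t * ∫⁻ b, f (t * a) (t * b) * φ (t * b) := by
      rw [h1, ← mul_assoc, ← ENNReal.ofReal_mul ht0.le, abs_of_pos (by positivity),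
        mul_inv_cancel₀ ht0.ne', ENNReal.ofReal_one, one_mul]
    have h3 : ∫⁻ b, f a b * φ b
        ≤ ENNReal.ofReal (t ^ 3) * ∫⁻ b, f (t * a) (t * b) * φ (t * b) := by
      rw [← lintegral_const_mul' _ _ ENNReal.ofReal_ne_top]
      refine lintegral_mono fun b => ?_
      rw [← mul_assoc, hf.homogeneous t ht0]
      gcongr
      refine hφ _ _ ?_
      rw [abs_mul, abs_of_pos ht0]
      exact le_mul_of_one_le_left (abs_nonneg b) ht
    rw [h2, marginDensity_mul ht0 a, ENNReal.mul_inv (Or.inr (marginDensity_ne_top _))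
      (Or.inl ENNReal.ofReal_ne_top), ← ENNReal.ofReal_inv_of_pos (by positivity)]
    calc _ ≤ ENNReal.ofReal (t ^ 2)⁻¹ * (marginDensity (t * a))⁻¹ *
          (ENNReal.ofReal (t ^ 3) * ∫⁻ b, f (t * a) (t * b) * φ (t * b)) := by gcongr
      _ = ENNReal.ofReal (t ^ 2)⁻¹ * ENNReal.ofReal (t ^ 3) * ((marginDensity (t * a))⁻¹ *
          ∫⁻ b, f (t * a) (t * b) * φ (t * b)) := by ring
      _ = ENNReal.ofReal t * ((marginDensity (t * a))⁻¹ *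
          ∫⁻ b, f (t * a) (t * b) * φ (t * b)) := by
          rw [← ENNReal.ofReal_mul (by positivity)]
          congr 2
          field_simp
      _ = _ := by ring
  intro a b hab
  rw [← habs a, ← habs b]
  rcases eq_or_ne a 0 with rfl | ha
  · rw [abs_zero, hf.transition_zero_right]
    exact zero_le
  · have ha0 : 0 < |a| := abs_pos.2 ha
    have := hscale (|b| / |a|) |a| ((one_le_div ha0).2 hab)
    rwa [div_mul_cancel₀ _ ha0.ne'] at this

theorem ae_ne_zero : ∀ᵐ a : ℝ, a ≠ 0 := Measure.ae_ne volume 0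

/-- Reversibility: both sides are the double integral of `ψ a * f a b * φ b`. -/
theorem IsEdgeKernel.lintegral_mul_transition (hf : IsEdgeKernel f) (hφ : Measurable φ)
    (hψ : Measurable ψ) :
    ∫⁻ a, marginDensity a * (ψ a * transition f φ a)
      = ∫⁻ b, marginDensity b * (φ b * transition (fun b a => f a b) ψ b) := by
  have key : ∀ {f : ℝ → ℝ → ℝ≥0∞} {φ ψ : ℝ → ℝ≥0∞}, IsEdgeKernel f → Measurable φ → Measurable ψ →
      ∫⁻ a, marginDensity a * (ψ a * transition f φ a) = ∫⁻ a, ∫⁻ b, ψ a * f a b * φ b := by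
    intro f φ ψ hf hφ hψ
    refine lintegral_congr_ae ?_
    filter_upwards [ae_ne_zero] with a ha
    have hm : Measurable fun b => f a b * φ b :=
      (hf.measurable_comp measurable_const measurable_id).mul hφ
    simp only [mul_assoc]
    rw [lintegral_const_mul _ hm, transition, mul_left_comm, ← mul_assoc (marginDensity a),
      ENNReal.mul_inv_cancel (marginDensity_ne_zero ha) (marginDensity_ne_top a), one_mul]
  rw [key hf hφ hψ, key hf.swap hψ hφ, lintegral_lintegral_swap]
  · refine lintegral_congr fun b => lintegral_congr fun a => ?_
    ring
  · exact (((hψ.comp measurable_fst).mul hf.measurable).mul (hφ.comp measurable_snd)).aemeasurable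

/-- Invariance of the margin: reversibility against the constant function one. -/
theorem IsEdgeKernel.lintegral_transition (hf : IsEdgeKernel f)
    (hφ : Measurable φ) :
    ∫⁻ a, marginDensity a * transition f φ a = ∫⁻ a, marginDensity a * φ a := by
  have h1 := hf.lintegral_mul_transition (ψ := 1) hφ measurable_one
  simp only [Pi.one_apply, one_mul] at h1
  rw [h1]
  refine lintegral_congr_ae ?_
  filter_upwards [ae_ne_zero] with a ha
  rw [hf.swap.transition_one ha, mul_one]

theorem lintegral_marginDensity_exceed_lt_top : ∫⁻ a, marginDensity a * exceed a < ∞ := by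
  have h1 : ∀ a, marginDensity a * exceed a
      ≤ (Set.Ioi (1 : ℝ)).indicator (fun x => ENNReal.ofReal (1 / x ^ 2)) a
        + (Set.Ioi (1 : ℝ)).indicator (fun x => ENNReal.ofReal (1 / x ^ 2)) (-a) := by
    intro a
    by_cases ha : 1 < |a|
    · rw [exceed_of_lt ha, mul_one]
      rcases lt_abs.1 ha with h | h
      · rw [Set.indicator_of_mem (s := Set.Ioi (1 : ℝ)) h]
        exact le_self_add
      · rw [Set.indicator_of_mem (s := Set.Ioi (1 : ℝ)) h, ← marginDensity_neg]
        exact le_add_self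
    · rw [exceed_of_le (not_lt.1 ha), mul_zero]
      exact zero_le
  refine (lintegral_mono h1).trans_lt ?_
  have hm : Measurable ((Set.Ioi (1 : ℝ)).indicator (fun x => ENNReal.ofReal (1 / x ^ 2))) :=
    Measurable.indicator (by fun_prop) measurableSet_Ioi
  rw [lintegral_add_left hm, lintegral_neg_eq_self
    ((Set.Ioi (1 : ℝ)).indicator (fun x => ENNReal.ofReal (1 / x ^ 2))),
    lintegral_indicator measurableSet_Ioi, lintegral_Ioi_one_div_sq]
  norm_num

/-- A radially monotone function that is nonzero at one point stays nonzero on a half-line, where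
the margin has positive density. -/
theorem lintegral_marginDensity_exceed_ne_zero {φ : ℝ → ℝ≥0∞} (hφ : Measurable φ)
    (hmono : RadialMono φ) (hpos : ∃ a, φ a ≠ 0) :
    ∫⁻ a, marginDensity a * (exceed a * φ a) ≠ 0 := by
  obtain ⟨a₀, ha₀⟩ := hpos
  intro h0
  rw [lintegral_eq_zero_iff (by fun_prop)] at h0
  have hsub : Set.Ioi (max 1 |a₀|) ⊆ {a | ¬ (marginDensity a * (exceed a * φ a) = 0)} := by
    intro a ha
    have ha' : max 1 |a₀| < a := ha
    have h1 : 1 < a := (le_max_left _ _).trans_lt ha'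
    have h2 : |a₀| ≤ |a| := ((le_max_right _ _).trans ha'.le).trans (le_abs_self a)
    have h3 : φ a ≠ 0 := fun h => ha₀ (le_antisymm ((hmono _ _ h2).trans h.le) (zero_le))
    change ¬ (marginDensity a * (exceed a * φ a) = 0)
    rw [exceed_of_lt (h1.trans_le (le_abs_self a)), one_mul]
    exact mul_ne_zero (marginDensity_ne_zero (by linarith)) h3
  have h4 : volume (Set.Ioi (max 1 |a₀|)) = 0 := measure_mono_null hsub h0
  rw [Real.volume_Ioi] at h4
  exact ENNReal.top_ne_zero h4

/-- Among weights `0 ≤ F ≤ 1` of given total mass, the indicator of `{1 < |a|}` gives the largest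
integral of a radially monotone function. -/
theorem lintegral_mul_le_of_radialMono {F : ℝ → ℝ≥0∞} (hφ : Measurable φ) (hmono : RadialMono φ)
    (hF : Measurable F) (hF1 : ∀ a, F a ≤ 1)
    (hmass : ∫⁻ a, marginDensity a * F a = ∫⁻ a, marginDensity a * exceed a) :
    ∫⁻ a, marginDensity a * (F a * φ a) ≤ ∫⁻ a, marginDensity a * (exceed a * φ a) := by
  set A : Set ℝ := {a | 1 < |a|} with hA
  have hAm : MeasurableSet A := measurableSet_one_lt_abs
  have hexc : ∀ χ : ℝ → ℝ≥0∞, ∫⁻ a, marginDensity a * (exceed a * χ a)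
      = ∫⁻ a in A, marginDensity a * χ a := by
    intro χ
    rw [← lintegral_indicator hAm]
    refine lintegral_congr fun a => ?_
    by_cases ha : 1 < |a|
    · rw [exceed_of_lt ha, one_mul, Set.indicator_of_mem (s := A) ha]
    · rw [exceed_of_le (not_lt.1 ha), zero_mul, mul_zero, Set.indicator_of_notMem (s := A) ha]
  have hexc1 : ∫⁻ a, marginDensity a * exceed a = ∫⁻ a in A, marginDensity a := by
    simpa using hexc 1
  have hfin : ∫⁻ a in A, marginDensity a * F a ≠ ∞ := by
    refine ne_top_of_le_ne_top lintegral_marginDensity_exceed_lt_top.ne ?_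
    rw [← hmass]
    exact setLIntegral_le_lintegral _ _
  have hsplit : ∀ χ : ℝ → ℝ≥0∞, Measurable χ → ∫⁻ a in A, marginDensity a * χ a
      = (∫⁻ a in A, marginDensity a * (F a * χ a))
        + ∫⁻ a in A, marginDensity a * ((1 - F a) * χ a) := by
    intro χ hχ
    rw [← lintegral_add_left (by fun_prop)]
    refine lintegral_congr fun a => ?_
    rw [← mul_add, ← add_mul, add_tsub_cancel_of_le (hF1 a), one_mul]
  -- The mass of `F` outside `A` equals what `F` lacks inside `A`. Moving it inside cannot lower the
  -- integral, since `φ ≤ φ 1` outside and `φ ≥ φ 1` inside.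
  have hcompl : ∫⁻ a in Aᶜ, marginDensity a * F a = ∫⁻ a in A, marginDensity a * (1 - F a) := by
    have h1 := hsplit 1 measurable_one
    simp only [Pi.one_apply, mul_one] at h1
    rw [hexc1, h1, ← lintegral_add_compl _ hAm] at hmass
    exact (ENNReal.add_right_inj hfin).1 hmass
  rw [hexc, hsplit φ hφ, ← lintegral_add_compl _ hAm]
  refine add_le_add le_rfl ?_
  calc ∫⁻ a in Aᶜ, marginDensity a * (F a * φ a)
      ≤ ∫⁻ a in Aᶜ, marginDensity a * F a * φ 1 := by
        refine setLIntegral_mono (by fun_prop) fun a ha => ?_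
        rw [← mul_assoc]
        gcongr
        refine hmono _ _ ?_
        rw [abs_one]
        exact not_lt.1 ha
    _ = ∫⁻ a in A, marginDensity a * (1 - F a) * φ 1 := by
        rw [lintegral_mul_const _ (by fun_prop), hcompl, lintegral_mul_const _ (by fun_prop)]
    _ ≤ ∫⁻ a in A, marginDensity a * ((1 - F a) * φ a) := by
        refine setLIntegral_mono (by fun_prop) fun a ha => ?_
        rw [← mul_assoc]
        gcongr
        refine hmono _ _ ?_
        rw [abs_one]
        exact le_of_lt ha

end EdgeKernel

/-! ### Exceedance probabilities along a walk -/

section PathTail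

variable {V : Type*} {T : SimpleGraph V} {K : V → V → ℝ → ℝ → ℝ≥0∞}

/-- The conditional probability, as a function of `Y_h`, that `|Y_l| > 1` for the Markov chain along
a walk from `h` to `l`. -/
noncomputable def pathTail (K : V → V → ℝ → ℝ → ℝ≥0∞) :
    ∀ {h l : V}, T.Walk h l → ℝ → ℝ≥0∞
  | _, _, .nil => exceed
  | _, _, .cons (u := h) (v := v) _ p => transition (K h v) (pathTail K p)

theorem measurable_pathTail (hK : ∀ i j, T.Adj i j → IsEdgeKernel (K i j))
    {h l : V} (p : T.Walk h l) : Measurable (pathTail K p) := by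
  induction p with
  | nil => exact measurable_exceed
  | cons hadj p ih => exact (hK _ _ hadj).measurable_transition ih

theorem radialMono_pathTail (hK : ∀ i j, T.Adj i j → IsEdgeKernel (K i j))
    {h l : V} (p : T.Walk h l) : RadialMono (pathTail K p) := by
  induction p with
  | nil => exact radialMono_exceed
  | cons hadj p ih => exact (hK _ _ hadj).radialMono_transition ih

theorem pathTail_le_one (hK : ∀ i j, T.Adj i j → IsEdgeKernel (K i j))
    {h l : V} (p : T.Walk h l) (a : ℝ) : pathTail K p a ≤ 1 := by
  induction p generalizing a with
  | nil => exact exceed_le_one a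
  | cons hadj p ih => exact (hK _ _ hadj).transition_le_one ih a

theorem exists_pathTail_ne_zero (hK : ∀ i j, T.Adj i j → IsEdgeKernel (K i j))
    {h l : V} (p : T.Walk h l) : ∃ a, pathTail K p a ≠ 0 := by
  induction p with
  | nil => exact ⟨2, by rw [pathTail, exceed_of_lt (by norm_num)]; exact one_ne_zero⟩
  | @cons u v w hadj p ih =>
    by_contra hcon
    push Not at hcon
    have hm := measurable_pathTail hK p
    -- If the transition vanished identically, invariance would make the integral of the shorter
    -- walk's tail vanish as well.
    have h1 := (hK _ _ hadj).lintegral_transition hm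
    have h2 : ∀ a, transition (K u v) (pathTail K p) a = 0 := hcon
    simp only [h2, mul_zero, lintegral_zero] at h1
    refine lintegral_marginDensity_exceed_ne_zero hm (radialMono_pathTail hK p) ih ?_
    refine le_antisymm (le_trans (lintegral_mono fun a => ?_) h1.ge) (zero_le)
    gcongr
    exact mul_le_of_le_one_left (zero_le) (exceed_le_one a)

/-- Dropping the first vertex of a walk does not decrease the joint exceedance mass of its
endpoints. -/
theorem lintegral_exceed_pathTail_cons_le (hK : ∀ i j, T.Adj i j → IsEdgeKernel (K i j))
    {u v l : V} (hadj : T.Adj u v) (p : T.Walk v l) :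
    ∫⁻ a, marginDensity a * (exceed a * pathTail K (.cons hadj p) a)
      ≤ ∫⁻ a, marginDensity a * (exceed a * pathTail K p a) := by
  have hf := hK _ _ hadj
  have hm := measurable_pathTail hK p
  have hmt := hf.swap.measurable_transition measurable_exceed
  -- Reversibility moves the operator onto `exceed`. The resulting weight is at most one and, by
  -- invariance, has the mass of `exceed`, as the bathtub inequality requires.
  rw [pathTail, hf.lintegral_mul_transition hm measurable_exceed]
  refine le_trans (le_of_eq (lintegral_congr fun a => by rw [mul_comm (pathTail K p a)]))
    (lintegral_mul_le_of_radialMono hm (radialMono_pathTail hK p) hmt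
    (hf.swap.transition_le_one exceed_le_one) (hf.swap.lintegral_transition measurable_exceed))

end PathTail

end LevyTree
namespace LevyTree

/-! ### Integrating out the vertices of the tree -/

section Elimination

variable {d : ℕ} {T : SimpleGraph (Fin d)} {K : Fin d → Fin d → ℝ → ℝ → ℝ≥0∞}

/-- The tree density of the subgraph of `T` induced by `S`, for bivariate densities `K`. -/
noncomputable def subDensity (T : SimpleGraph (Fin d)) (K : Fin d → Fin d → ℝ → ℝ → ℝ≥0∞)
    (S : Finset (Fin d)) (y : Fin d → ℝ) : ℝ≥0∞ :=
  (∏ e ∈ (edgePairs T).filter fun e => e.1 ∈ S ∧ e.2 ∈ S, K e.1 e.2 (y e.1) (y e.2)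
      / (marginDensity (y e.1) * marginDensity (y e.2)))
    * ∏ i ∈ S, marginDensity (y i)

open Classical in
theorem adj_of_mem_edgePairs {e : Fin d × Fin d} (he : e ∈ edgePairs T) : T.Adj e.1 e.2 :=
  ((Finset.mem_filter.1 he).2).2

open Classical in
theorem lt_of_mem_edgePairs {e : Fin d × Fin d} (he : e ∈ edgePairs T) : e.1 < e.2 :=
  ((Finset.mem_filter.1 he).2).1

theorem measurable_subDensity (hK : ∀ i j, T.Adj i j → IsEdgeKernel (K i j))
    (S : Finset (Fin d)) : Measurable (subDensity T K S) := by
  refine Measurable.mul (Finset.measurable_prod _ fun e he => ?_)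
    (Finset.measurable_prod _ fun i _ => by fun_prop)
  have hadj := adj_of_mem_edgePairs (Finset.mem_filter.1 he).1
  exact ((hK _ _ hadj).measurable_comp (by fun_prop) (by fun_prop)).div (by fun_prop)

theorem subDensity_congr {S : Finset (Fin d)} {y z : Fin d → ℝ} (h : ∀ i ∈ S, y i = z i) :
    subDensity T K S y = subDensity T K S z := by
  unfold subDensity
  congr 1
  · refine Finset.prod_congr rfl fun e he => ?_
    have := (Finset.mem_filter.1 he).2
    rw [h _ this.1, h _ this.2]
  · exact Finset.prod_congr rfl fun i hi => by rw [h i hi]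

theorem subDensity_eq_zero {S : Finset (Fin d)} {u : Fin d} (hu : u ∈ S) {y : Fin d → ℝ}
    (hy : y u = 0) : subDensity T K S y = 0 := by
  unfold subDensity
  rw [Finset.prod_eq_zero hu (by rw [hy, marginDensity_zero]), mul_zero]

/-- A leaf brings in exactly one edge. That edge may be listed in either order depending on the
labels, which is where the symmetry of `K` enters. -/
theorem subDensity_insert (hsymm : ∀ i j a b, K i j a b = K j i b a) {S : Finset (Fin d)}
    {u v : Fin d} (hv : v ∉ S) (hu : u ∈ S) (hadj : T.Adj u v)
    (huniq : ∀ w ∈ S, T.Adj w v → w = u) (y : Fin d → ℝ) :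
    subDensity T K (insert v S) y = subDensity T K S y *
      (K u v (y u) (y v) / (marginDensity (y u) * marginDensity (y v)) * marginDensity (y v)) := by
  have hne : u ≠ v := hadj.ne
  have hnew : ∀ e : Fin d × Fin d,
      (e = (u, v) ∧ u < v ∨ e = (v, u) ∧ v < u) → ((edgePairs T).filter fun e =>
        e.1 ∈ insert v S ∧ e.2 ∈ insert v S)
        = insert e ((edgePairs T).filter fun e => e.1 ∈ S ∧ e.2 ∈ S) := by
    intro e he
    ext ⟨i, j⟩
    simp only [Finset.mem_filter, Finset.mem_insert, edgePairs, Finset.mem_univ, true_and]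
    constructor
    · rintro ⟨⟨hij, hadj'⟩, hi, hj⟩
      rcases hi with rfl | hi <;> rcases hj with rfl | hj
      · exact absurd hij (lt_irrefl _)
      · have := huniq j hj hadj'.symm
        subst this
        left
        rcases he with ⟨rfl, h⟩ | ⟨rfl, h⟩
        · exact absurd hij (lt_asymm h)
        · rfl
      · have := huniq i hi hadj'
        subst this
        left
        rcases he with ⟨rfl, h⟩ | ⟨rfl, h⟩
        · rfl
        · exact absurd hij (lt_asymm h)
      · exact Or.inr ⟨⟨hij, hadj'⟩, hi, hj⟩
    · rintro (h | ⟨h, hi, hj⟩)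
      · rcases he with ⟨rfl, h'⟩ | ⟨rfl, h'⟩
        · obtain ⟨rfl, rfl⟩ := Prod.mk.inj h
          exact ⟨⟨h', hadj⟩, Or.inr hu, Or.inl rfl⟩
        · obtain ⟨rfl, rfl⟩ := Prod.mk.inj h
          exact ⟨⟨h', hadj.symm⟩, Or.inl rfl, Or.inr hu⟩
      · exact ⟨h, Or.inr hi, Or.inr hj⟩
  unfold subDensity
  rw [Finset.prod_insert hv]
  rcases lt_or_gt_of_ne hne with hlt | hlt
  · rw [hnew (u, v) (Or.inl ⟨rfl, hlt⟩), Finset.prod_insert]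
    · ring
    · simp [hv]
  · rw [hnew (v, u) (Or.inr ⟨rfl, hlt⟩), Finset.prod_insert]
    · simp only [hsymm v u (y v) (y u), mul_comm (marginDensity (y v)) (marginDensity (y u))]
      ring
    · simp [hv]

theorem div_mul_marginDensity_cancel {f : ℝ → ℝ → ℝ≥0∞} {a b : ℝ} (hb : b ≠ 0) :
    f a b / (marginDensity a * marginDensity b) * marginDensity b
      = (marginDensity a)⁻¹ * f a b := by
  rw [ENNReal.div_eq_inv_mul, ENNReal.mul_inv (Or.inr (marginDensity_ne_top b))
    (Or.inl (marginDensity_ne_top a))]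
  calc _ = (marginDensity a)⁻¹ * f a b * ((marginDensity b)⁻¹ * marginDensity b) := by ring
    _ = _ := by
      rw [ENNReal.inv_mul_cancel (marginDensity_ne_zero hb) (marginDensity_ne_top b), mul_one]

/-- Integrating out a vertex `v` that is attached to `S` by a single edge. -/
theorem lmarginal_insert_subDensity (hK : ∀ i j, T.Adj i j → IsEdgeKernel (K i j))
    (hsymm : ∀ i j a b, K i j a b = K j i b a) {S : Finset (Fin d)}
    {u v : Fin d} (hv : v ∉ S) (hu : u ∈ S) (hadj : T.Adj u v)
    (huniq : ∀ w ∈ S, T.Adj w v → w = u) {ψ : ℝ → ℝ≥0∞} (hψ : Measurable ψ)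
    {Φ : (Fin d → ℝ) → ℝ≥0∞} (hΦ : Measurable Φ)
    (hΦv : ∀ y b, Φ (Function.update y v b) = Φ y) :
    (∫⋯∫⁻_insert v S, fun y => subDensity T K (insert v S) y * (ψ (y v) * Φ y))
      = ∫⋯∫⁻_S, fun y => subDensity T K S y * (transition (K u v) ψ (y u) * Φ y) := by
  have hf := hK _ _ hadj
  have hm := measurable_subDensity hK (insert v S)
  rw [lmarginal_insert' _ (by fun_prop) hv]
  congr 1
  funext y
  have hS : ∀ b, subDensity T K S (Function.update y v b) = subDensity T K S y := fun b =>
    subDensity_congr fun i hi => Function.update_of_ne (by rintro rfl; exact hv hi) _ _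
  have hyu : ∀ b, Function.update y v b u = y u := fun b =>
    Function.update_of_ne hadj.ne _ _
  simp only [subDensity_insert hsymm hv hu hadj huniq, hS, hyu, Function.update_self, hΦv]
  have hmb : Measurable fun b => K u v (y u) b * ψ b :=
    (hf.measurable_comp measurable_const measurable_id).mul hψ
  have h1 : ∫⁻ b, subDensity T K S y * (K u v (y u) b / (marginDensity (y u) * marginDensity b) *
      marginDensity b) * (ψ b * Φ y)
      = ∫⁻ b, subDensity T K S y * (marginDensity (y u))⁻¹ * Φ y * (K u v (y u) b * ψ b) := by
    refine lintegral_congr_ae ?_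
    filter_upwards [ae_ne_zero] with b hb
    rw [div_mul_marginDensity_cancel hb]
    ring
  rw [h1, lintegral_const_mul _ hmb, transition]
  ring

/-- `S` is connected inside `T`. -/
def WalkConnected (T : SimpleGraph (Fin d)) (S : Finset (Fin d)) : Prop :=
  ∀ x ∈ S, ∀ y ∈ S, ∃ p : T.Walk x y, ∀ z ∈ p.support, z ∈ S

/-- A second neighbour `w` of `v` in `S` would give a path from `v` to `u` through `w` besides the
single edge. Uniqueness of paths forces the part from `w` to `u` to have length zero. -/
theorem WalkConnected.eq_of_adj {S : Finset (Fin d)} (hS : WalkConnected T S) (hT : T.IsAcyclic)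
    {u v w : Fin d} (hv : v ∉ S) (hu : u ∈ S) (hw : w ∈ S) (huv : T.Adj u v) (hwv : T.Adj w v) :
    w = u := by
  obtain ⟨p, hp⟩ := hS w hw u hu
  have hq : p.bypass.IsPath := p.bypass_isPath
  have hvq : v ∉ p.bypass.support := fun h => hv (hp v (p.support_bypass_subset_support h))
  have h1 : (SimpleGraph.Walk.cons hwv.symm p.bypass).IsPath := hq.cons hvq
  have h2 : (SimpleGraph.Walk.cons huv.symm SimpleGraph.Walk.nil).IsPath := by
    simp [huv.ne']
  have h3 := congrArg (fun q : T.Path v u => q.1.length) 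
    ((hT.subsingleton_path v u).elim ⟨_, h1⟩ ⟨_, h2⟩)
  simp only [SimpleGraph.Walk.length_cons, SimpleGraph.Walk.length_nil] at h3
  exact SimpleGraph.Walk.eq_of_length_eq_zero (p := p.bypass) (by omega)

theorem WalkConnected.insert_of_adj {S : Finset (Fin d)} (hS : WalkConnected T S) {u v : Fin d}
    (hu : u ∈ S) (huv : T.Adj u v) : WalkConnected T (insert v S) := by
  have hto : ∀ x ∈ insert v S, ∃ p : T.Walk x u, ∀ z ∈ p.support, z ∈ insert v S := by
    intro x hx
    rcases Finset.mem_insert.1 hx with rfl | hx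
    · refine ⟨.cons huv.symm .nil, fun z hz => ?_⟩
      simp only [SimpleGraph.Walk.support_cons, SimpleGraph.Walk.support_nil, List.mem_cons,
        List.not_mem_nil, or_false] at hz
      rcases hz with rfl | rfl
      · exact Finset.mem_insert_self _ _
      · exact Finset.mem_insert_of_mem hu
    · obtain ⟨p, hp⟩ := hS x hx u hu
      exact ⟨p, fun z hz => Finset.mem_insert_of_mem (hp z hz)⟩
  intro x hx y hy
  obtain ⟨p, hp⟩ := hto x hx
  obtain ⟨q, hq⟩ := hto y hy
  refine ⟨p.append q.reverse, fun z hz => ?_⟩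
  rcases (SimpleGraph.Walk.mem_support_append_iff _ _).1 hz with hz | hz
  · exact hp z hz
  · exact hq z (by simpa using hz)

theorem walkConnected_support {h l : Fin d} (p : T.Walk h l) :
    WalkConnected T p.support.toFinset := by
  induction p with
  | @nil u =>
    intro x hx y hy
    simp only [SimpleGraph.Walk.support_nil, List.toFinset_cons, List.toFinset_nil,
      insert_empty_eq, Finset.mem_singleton] at hx hy
    subst hx
    subst hy
    exact ⟨.nil, by simp⟩
  | @cons u v w hadj p ih =>
    rw [SimpleGraph.Walk.support_cons, List.toFinset_cons]
    exact ih.insert_of_adj (by simp) hadj.symm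

/-- Integrating out all vertices outside a connected set `S`. -/
theorem lmarginal_univ_subDensity (hT : T.IsTree) (hK : ∀ i j, T.Adj i j → IsEdgeKernel (K i j))
    (hsymm : ∀ i j a b, K i j a b = K j i b a) {Φ : (Fin d → ℝ) → ℝ≥0∞} (hΦ : Measurable Φ)
    {S : Finset (Fin d)} (hS : WalkConnected T S) (hne : S.Nonempty)
    (hΦS : ∀ v ∉ S, ∀ y b, Φ (Function.update y v b) = Φ y) :
    (∫⋯∫⁻_Finset.univ, fun y => subDensity T K Finset.univ y * Φ y)
      = ∫⋯∫⁻_S, fun y => subDensity T K S y * Φ y := by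
  -- `S` is enlarged by one adjacent vertex at a time until it is everything. The added vertex is a
  -- leaf of the larger set, and its kernel integrates to one.
  induction hn : Sᶜ.card generalizing S with
  | zero =>
    rw [Finset.card_eq_zero, Finset.compl_eq_empty_iff] at hn
    rw [hn]
  | succ n ih =>
    obtain ⟨v₀, hv₀⟩ : ∃ v, v ∉ S := by
      by_contra hcon
      push Not at hcon
      have : Sᶜ = ∅ := by
        rw [Finset.compl_eq_empty_iff]
        exact Finset.eq_univ_of_forall hcon
      rw [this] at hn
      simp at hn
    obtain ⟨u₀, hu₀⟩ := hne
    obtain ⟨p⟩ := hT.connected u₀ v₀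
    obtain ⟨e, -, hu, hv⟩ := p.exists_boundary_dart (S : Set (Fin d)) hu₀ hv₀
    rw [Finset.mem_coe] at hu hv
    have hadj : T.Adj e.fst e.snd := e.adj
    have hcard : (insert e.snd S)ᶜ.card = n := by
      rw [Finset.card_compl, Finset.card_insert_of_notMem hv, ← Nat.sub_sub, ← Finset.card_compl,
        hn, Nat.add_sub_cancel]
    rw [ih (hS.insert_of_adj hu hadj) (Finset.insert_nonempty _ _)
      (fun v hv' => hΦS v fun h => hv' (Finset.mem_insert_of_mem h)) hcard]
    have h1 := lmarginal_insert_subDensity hK hsymm hv hu hadj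
      (fun w hw hwv => hS.eq_of_adj hT.isAcyclic hv hu hw hadj hwv)
      (ψ := 1) measurable_one hΦ (hΦS _ hv)
    simp only [Pi.one_apply, one_mul] at h1
    rw [h1]
    congr 1
    funext y
    rcases eq_or_ne (y e.fst) 0 with hy | hy
    · rw [subDensity_eq_zero hu hy, zero_mul, zero_mul]
    · have := (hK _ _ hadj).transition_one hy
      rw [this, one_mul]

/-- Integrating out a path from its first vertex to its last. -/
theorem lmarginal_path_subDensity (hT : T.IsAcyclic)
    (hK : ∀ i j, T.Adj i j → IsEdgeKernel (K i j)) (hsymm : ∀ i j a b, K i j a b = K j i b a)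
    {h l : Fin d} (p : T.Walk h l) (hp : p.IsPath) {φ : ℝ → ℝ≥0∞} (hφ : Measurable φ)
    (x : Fin d → ℝ) :
    (∫⋯∫⁻_p.support.toFinset, fun y => subDensity T K p.support.toFinset y *
        (φ (y h) * exceed (y l))) x
      = ∫⁻ a, marginDensity a * (φ a * pathTail K p a) := by
  induction p generalizing φ with
  | @nil u =>
    have hempty : ((edgePairs T).filter fun e => e.1 ∈ ({u} : Finset (Fin d)) ∧ e.2 ∈
        ({u} : Finset (Fin d))) = ∅ := by
      rw [Finset.filter_eq_empty_iff]
      rintro ⟨i, j⟩ he ⟨hi, hj⟩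
      have := lt_of_mem_edgePairs he
      simp only [Finset.mem_singleton] at hi hj
      rw [hi, hj] at this
      exact lt_irrefl _ this
    simp only [SimpleGraph.Walk.support_nil, List.toFinset_cons, List.toFinset_nil,
      insert_empty_eq, lmarginal_singleton, subDensity, hempty, Finset.prod_empty, one_mul,
      Finset.prod_singleton, Function.update_self, pathTail]
  | @cons h v l hadj p ih =>
    rw [SimpleGraph.Walk.cons_isPath_iff] at hp
    have hmem : h ∉ p.support.toFinset := by simpa using hp.2
    have hv : v ∈ p.support.toFinset := by simp
    have hlh : l ≠ h := by
      rintro rfl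
      exact hp.2 p.end_mem_support
    rw [SimpleGraph.Walk.support_cons, List.toFinset_cons,
      lmarginal_insert_subDensity hK hsymm hmem hv hadj.symm
      (fun w hw hwh => (walkConnected_support p).eq_of_adj hT hmem hv hw hadj.symm hwh) hφ
      (Φ := fun y => exceed (y l)) (by fun_prop)
      (fun y b => by rw [Function.update_of_ne hlh])]
    have hvh := hK _ _ hadj.symm
    rw [ih hp.1 (hvh.measurable_transition hφ), pathTail]
    -- Eliminating `h` applies the backward kernel to `φ`, while `pathTail` conditions on `h` and
    -- uses the forward one; reversibility matches the two.
    have hKs : K h v = fun a b => K v h b a := by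
      funext a b
      exact hsymm _ _ _ _
    rw [hKs, hvh.swap.lintegral_mul_transition (measurable_pathTail hK p) hφ]
    exact lintegral_congr fun b => by rw [mul_comm (pathTail K p b)]

/-- The joint exceedance mass of the endpoints of a path under the tree density. -/
theorem lintegral_subDensity_univ (hT : T.IsTree)
    (hK : ∀ i j, T.Adj i j → IsEdgeKernel (K i j)) (hsymm : ∀ i j a b, K i j a b = K j i b a)
    {h l : Fin d} (p : T.Walk h l) (hp : p.IsPath) :
    ∫⁻ y, subDensity T K Finset.univ y * (exceed (y h) * exceed (y l))
      = ∫⁻ a, marginDensity a * (exceed a * pathTail K p a) := by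
  rw [volume_pi, lintegral_eq_lmarginal_univ 0,
    lmarginal_univ_subDensity hT hK hsymm (Φ := fun y => exceed (y h) * exceed (y l))
      (by fun_prop) (walkConnected_support p) ⟨h, by simp⟩ ?_,
    lmarginal_path_subDensity hT.isAcyclic hK hsymm p hp measurable_exceed]
  intro v hv y b
  have h1 : h ≠ v := by rintro rfl; exact hv (by simp)
  have h2 : l ≠ v := by rintro rfl; exact hv (by simp)
  simp only [Function.update_of_ne h1, Function.update_of_ne h2]

end Elimination

end LevyTree
namespace LevyTree

/-! ### Lévy correlations of the model and their monotonicity along paths -/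

section LevyCorrelation

variable {d : ℕ}

/-- Fubini in the coordinates `i` and `j`, with the others frozen. It lifts almost-everywhere
equality of edge densities from the plane to the whole space. -/
theorem quasiMeasurePreserving_pair {i j : Fin d} (hij : i ≠ j) :
    Measure.QuasiMeasurePreserving (fun y : Fin d → ℝ => (y i, y j)) volume volume := by
  refine ⟨by fun_prop, Measure.AbsolutelyContinuous.mk fun N hN hN0 => ?_⟩
  rw [Measure.map_apply (by fun_prop) hN]
  have hm : Measurable fun y : Fin d → ℝ => N.indicator (1 : ℝ × ℝ → ℝ≥0∞) (y i, y j) :=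
    (measurable_one.indicator hN).comp (by fun_prop)
  have hpre : MeasurableSet ((fun y : Fin d → ℝ => (y i, y j)) ⁻¹' N) :=
    hN.preimage (by fun_prop)
  rw [← lintegral_indicator_one hpre, volume_pi]
  suffices hzero : (∫⋯∫⁻_{i, j}, fun y : Fin d → ℝ => N.indicator (1 : ℝ × ℝ → ℝ≥0∞) (y i, y j))
      = ∫⋯∫⁻_{i, j}, (0 : (Fin d → ℝ) → ℝ≥0∞) from
    (lintegral_eq_of_lmarginal_eq {i, j} hm measurable_zero hzero).trans lintegral_zero
  funext x
  rw [lmarginal_insert _ hm (by simpa using hij), lmarginal_insert _ measurable_zero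
    (by simpa using hij)]
  simp only [lmarginal_singleton, Function.update_self, Function.update_of_ne hij,
    Pi.zero_apply, lintegral_zero]
  rw [← lintegral_prod (fun z : ℝ × ℝ => N.indicator 1 z)
    (measurable_one.indicator hN).aemeasurable, ← Measure.volume_eq_prod,
    lintegral_indicator_one hN, hN0]

theorem quasiMeasurePreserving_abs :
    Measure.QuasiMeasurePreserving (fun a : ℝ => |a|) volume volume := by
  refine ⟨by fun_prop, Measure.AbsolutelyContinuous.mk fun N hN hN0 => ?_⟩
  rw [Measure.map_apply (by fun_prop) hN]
  refine measure_mono_null (t := N ∪ (fun a : ℝ => -a) ⁻¹' N) (fun a ha => ?_)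
    (measure_union_null hN0 ?_)
  · rcases abs_choice a with h | h
    · exact Or.inl (by rw [← h]; exact ha)
    · refine Or.inr ?_
      change -a ∈ N
      rw [← h]
      exact ha
  · rw [Measure.measure_preimage_neg]
    exact hN0

theorem ae_pair_abs_eq {f g : ℝ × ℝ → ℝ≥0∞} (hfg : f =ᵐ[volume] g) {i j : Fin d} (hij : i ≠ j) :
    ∀ᵐ y : Fin d → ℝ, f (|y i|, |y j|) = g (|y i|, |y j|) := by
  have h := QuasiMeasurePreserving.prodMap quasiMeasurePreserving_abs quasiMeasurePreserving_abs
  rw [← Measure.volume_eq_prod] at h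
  exact (h.comp (quasiMeasurePreserving_pair hij)).ae hfg

/-- The joint exceedance masses of a tree measure, in terms of the Markov chains along the paths. -/
theorem exists_kernel_tree_measure {T : SimpleGraph (Fin d)} (hT : T.IsTree)
    {m : Fin d → Fin d → ℝ} {g : Fin d → Fin d → ℝ × ℝ → ℝ≥0∞}
    (hmg : ∀ e ∈ edgePairs T, m e.1 e.2 ∈ Set.Icc (0 : ℝ) 1 ∧ IsPositiveModel (g e.1 e.2)) :
    ∃ K : Fin d → Fin d → ℝ → ℝ → ℝ≥0∞, (∀ i j, T.Adj i j → IsEdgeKernel (K i j)) ∧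
      ∀ (h l : Fin d) (p : T.Walk h l), p.IsPath →
        (volume.withDensity (treeDensity T m g)) {y | 1 < |y h| ∧ 1 < |y l|}
          = ∫⁻ a, marginDensity a * (exceed a * pathTail K p a) := by
  classical
  have hver : ∀ i j, (i, j) ∈ edgePairs T → ∃ f : ℝ × ℝ → ℝ≥0∞,
      f =ᵐ[volume] g i j ∧ IsEdgeKernel (edgeDensity (m i j) f) := by
    intro i j hij
    obtain ⟨hm, hg⟩ := hmg _ hij
    obtain ⟨f, hfm, hfg, hsupp, hhom, h1, h2⟩ := hg.exists_homogeneous_version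
    exact ⟨f, hfg, isEdgeKernel_edgeDensity hm hfm hsupp hhom h1 h2⟩
  choose! f hfg hker using hver
  -- The model data matter only for `i < j`; the reversed pair receives the transposed density, so
  -- that walks can use an edge in both directions.
  set K : Fin d → Fin d → ℝ → ℝ → ℝ≥0∞ := fun i j a b =>
    if i < j then edgeDensity (m i j) (f i j) a b
    else if j < i then edgeDensity (m j i) (f j i) b a else 0 with hKdef
  have hlt : ∀ {i j}, i < j → K i j = edgeDensity (m i j) (f i j) := by
    intro i j hij
    funext a b
    simp only [hKdef, if_pos hij]
  have hgt : ∀ {i j}, j < i → K i j = fun a b => edgeDensity (m j i) (f j i) b a := by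
    intro i j hij
    funext a b
    simp only [hKdef, if_neg (lt_asymm hij), if_pos hij]
  have hmem : ∀ {i j}, i < j → T.Adj i j → (i, j) ∈ edgePairs T := fun hij hadj =>
    Finset.mem_filter.2 ⟨Finset.mem_univ _, hij, hadj⟩
  have hK : ∀ i j, T.Adj i j → IsEdgeKernel (K i j) := by
    intro i j hadj
    rcases lt_or_gt_of_ne hadj.ne with hij | hij
    · rw [hlt hij]
      exact hker _ _ (hmem hij hadj)
    · rw [hgt hij]
      exact (hker _ _ (hmem hij hadj.symm)).swap
  have hsymm : ∀ i j a b, K i j a b = K j i b a := by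
    intro i j a b
    rcases lt_trichotomy i j with hij | rfl | hij
    · rw [hlt hij, hgt hij]
    · simp [hKdef]
    · rw [hlt hij, hgt hij]
  refine ⟨K, hK, fun h l p hp => ?_⟩
  rw [← lintegral_subDensity_univ hT hK hsymm p hp]
  have hA : MeasurableSet {y : E d | 1 < |y h| ∧ 1 < |y l|} := by
    have h1 : MeasurableSet {y : E d | 1 < |y h|} :=
      measurableSet_lt measurable_const (by fun_prop)
    have h2 : MeasurableSet {y : E d | 1 < |y l|} :=
      measurableSet_lt measurable_const (by fun_prop)
    exact h1.inter h2
  rw [withDensity_apply _ hA, ← lintegral_indicator hA,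
    ← (PiLp.volume_preserving_toLp (Fin d)).lintegral_comp_emb
      (MeasurableEquiv.toLp 2 (Fin d → ℝ)).measurableEmbedding]
  refine lintegral_congr_ae ?_
  have hall : ∀ᵐ y : Fin d → ℝ, ∀ e ∈ edgePairs T,
      f e.1 e.2 (|y e.1|, |y e.2|) = g e.1 e.2 (|y e.1|, |y e.2|) := by
    rw [eventually_all_finset]
    exact fun e he => ae_pair_abs_eq (hfg _ _ he) (lt_of_mem_edgePairs he).ne
  filter_upwards [hall] with y hy
  have hdens : treeDensity T m g (WithLp.toLp 2 y) = subDensity T K Finset.univ y := by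
    unfold treeDensity subDensity
    simp only [Finset.mem_univ, and_self, Finset.filter_true]
    congr 1
    refine Finset.prod_congr rfl fun e he => ?_
    rw [hlt (lt_of_mem_edgePairs he), edgeDensity, edgeDensity, hy e he]
  by_cases hh : 1 < |y h|
  · by_cases hl : 1 < |y l|
    · rw [exceed_of_lt hh, exceed_of_lt hl, mul_one, mul_one, ← hdens,
        Set.indicator_of_mem (s := {y : E d | 1 < |y h| ∧ 1 < |y l|}) ⟨hh, hl⟩]
    · rw [exceed_of_le (not_lt.1 hl), mul_zero, mul_zero,
        Set.indicator_of_notMem (s := {y : E d | 1 < |y h| ∧ 1 < |y l|}) fun h' => hl h'.2]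
  · rw [exceed_of_le (not_lt.1 hh), zero_mul, mul_zero,
      Set.indicator_of_notMem (s := {y : E d | 1 < |y h| ∧ 1 < |y l|}) fun h' => hh h'.1]

theorem chi_comm (μ : Measure (E d)) (i j : Fin d) : chi μ i j = chi μ j i := by
  unfold chi
  congr 3
  ext y
  exact and_comm

/-- The exceedance masses of `Λstar` are those of the tree measure, because both carry the
dependence structure of `Λ`. -/
theorem IsHeteroStableTree.chi_eq {T : SimpleGraph (Fin d)} {Λ Λstar : Measure (E d)}
    (hmodel : IsHeteroStableTree T Λ) (hdep : SameDependence Λ Λstar) :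
    ∃ K : Fin d → Fin d → ℝ → ℝ → ℝ≥0∞, (∀ i j, T.Adj i j → IsEdgeKernel (K i j)) ∧
      ∀ (h l : Fin d) (p : T.Walk h l), p.IsPath →
        chi Λstar h l = (∫⁻ a, marginDensity a * (exceed a * pathTail K p a)).toReal / 2 := by
  obtain ⟨hT, -, m, g, cpos, cneg, α, hmg, hc, htail, hdep'⟩ := hmodel
  obtain ⟨K, hK, hval⟩ := exists_kernel_tree_measure hT hmg
  refine ⟨K, hK, fun h l p hp => ?_⟩
  have h1 := measure_abs_gt_eq_of_sameDependence hc htail hdep hdep' {h, l}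
  simp only [Set.mem_insert_iff, Set.mem_singleton_iff, forall_eq_or_imp, forall_eq] at h1
  rw [chi, h1, hval h l p hp]

theorem lintegral_exceed_pathTail_ne_top {V : Type*} {T : SimpleGraph V}
    {K : V → V → ℝ → ℝ → ℝ≥0∞} (hK : ∀ i j, T.Adj i j → IsEdgeKernel (K i j)) {h l : V}
    (p : T.Walk h l) : ∫⁻ a, marginDensity a * (exceed a * pathTail K p a) ≠ ∞ := by
  refine ne_top_of_le_ne_top lintegral_marginDensity_exceed_lt_top.ne (lintegral_mono fun a => ?_)
  gcongr
  exact mul_le_of_le_one_right zero_le (pathTail_le_one hK p a)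

theorem IsHeteroStableTree.chi_pos {T : SimpleGraph (Fin d)} {Λ Λstar : Measure (E d)}
    (hmodel : IsHeteroStableTree T Λ) (hdep : SameDependence Λ Λstar) (h l : Fin d) :
    0 < chi Λstar h l := by
  obtain ⟨K, hK, hval⟩ := hmodel.chi_eq hdep
  obtain ⟨p, hp⟩ := hmodel.1.connected.exists_isPath h l
  rw [hval h l p hp]
  exact half_pos (ENNReal.toReal_pos (lintegral_marginDensity_exceed_ne_zero
    (measurable_pathTail hK p) (radialMono_pathTail hK p) (exists_pathTail_ne_zero hK p))
    (lintegral_exceed_pathTail_ne_top hK p))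

/-- The path loses its first vertex repeatedly until it starts at `x`. -/
theorem IsHeteroStableTree.chi_le_of_mem_support {T : SimpleGraph (Fin d)}
    {Λ Λstar : Measure (E d)} (hmodel : IsHeteroStableTree T Λ) (hdep : SameDependence Λ Λstar)
    {h l x : Fin d} (p : T.Walk h l) (hp : p.IsPath) (hx : x ∈ p.support) :
    chi Λstar h l ≤ chi Λstar x l := by
  obtain ⟨K, hK, hval⟩ := hmodel.chi_eq hdep
  induction p with
  | nil =>
    rw [SimpleGraph.Walk.mem_support_nil_iff] at hx
    rw [hx]
  | @cons u v w hadj p ih =>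
    rcases List.mem_cons.1 (by rwa [SimpleGraph.Walk.support_cons] at hx) with rfl | hx
    · exact le_rfl
    · have hp' := ((SimpleGraph.Walk.cons_isPath_iff _ _).1 hp).1
      refine le_trans ?_ (ih hp' hx)
      rw [hval _ _ _ hp, hval _ _ _ hp']
      exact div_le_div_of_nonneg_right (ENNReal.toReal_mono
        (lintegral_exceed_pathTail_ne_top hK p) (lintegral_exceed_pathTail_cons_le hK hadj p))
        zero_le_two

/-- The Lévy correlation of the endpoints of a path is at most that of any two of its vertices. -/
theorem IsHeteroStableTree.chi_le {T : SimpleGraph (Fin d)}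
    {Λ Λstar : Measure (E d)} (hmodel : IsHeteroStableTree T Λ) (hdep : SameDependence Λ Λstar)
    {h l x y : Fin d} (p : T.Walk h l) (hp : p.IsPath) (hx : x ∈ p.support) (hy : y ∈ p.support) :
    chi Λstar h l ≤ chi Λstar x y := by
  -- The path is cut at `x`, and `y` lies on one of the two pieces. One trimming moves an end to
  -- `x`, a second one, after reversal where needed, moves the other end to `y`.
  rw [← p.take_spec hx, SimpleGraph.Walk.mem_support_append_iff] at hy
  rcases hy with hy | hy
  · have h1 := hmodel.chi_le_of_mem_support hdep p.reverse hp.reverse (by simpa using hx)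
    have h2 := hmodel.chi_le_of_mem_support hdep (p.takeUntil x hx) (hp.takeUntil hx) hy
    rw [chi_comm _ h l, chi_comm _ x y]
    rw [chi_comm _ h x] at h2
    exact h1.trans h2
  · have h1 := hmodel.chi_le_of_mem_support hdep p hp hx
    have h2 := hmodel.chi_le_of_mem_support hdep (p.dropUntil x hx).reverse
      (hp.dropUntil hx).reverse (by simpa using hy)
    rw [chi_comm _ x y]
    rw [chi_comm _ l x] at h2
    exact h1.trans h2

end LevyCorrelation

end LevyTree

theorem proposition6p2 {d : ℕ} {Ω : Type*} [MeasurableSpace Ω] (P : Measure Ω)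
    [IsProbabilityMeasure P] (X : ℝ≥0 → Ω → LevyTree.E d)
    (γ : LevyTree.E d) (Λ Λstar : Measure (LevyTree.E d)) (T : SimpleGraph (Fin d))
    (hX : LevyTree.IsLevyProcess P X)
    (htriplet : LevyTree.HasTriplet P X γ 0 Λ)
    (hmodel : LevyTree.IsHeteroStableTree T Λ)
    (hstd : LevyTree.IsStandardizedOf Λstar Λ) :
    (∀ (h l i j : Fin d) (p : T.Walk h l), p.IsPath → s(i, j) ∈ p.edges →
      LevyTree.chi Λstar h l ≤ LevyTree.chi Λstar i j) ∧
    ((∀ (h l i j : Fin d) (p : T.Walk h l), p.IsPath → s(i, j) ∈ p.edges → s(i, j) ≠ s(h, l) →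
        LevyTree.chi Λstar h l < LevyTree.chi Λstar i j) →
      ∀ G : SimpleGraph (Fin d),
        LevyTree.IsMinSpanningTree (fun i j => -Real.log (LevyTree.chi Λstar i j)) G ↔ G = T) := by
  have hdep := hstd.sameDependence
  refine ⟨fun h l i j p hp he => hmodel.chi_le hdep p hp (p.fst_mem_support_of_mem_edges he)
    (p.snd_mem_support_of_mem_edges he), fun hlt G => ?_⟩
  refine LevyTree.isMinSpanningTree_iff_eq hmodel.1 _
    (fun i j => by rw [LevyTree.chi_comm]) (fun h l i j p hp he hne => ?_) G
  -- Positivity of the smaller correlation is essential here, since `Real.log 0 = 0`.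
  exact neg_lt_neg (Real.log_lt_log (hmodel.chi_pos hdep h l) (hlt h l i j p hp he hne))
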